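/- Let $q$ be a natural number, let $A=(a_1,\ldots,a_q)$, $B=(b_1,\ldots,b_q)$ be vectors of complex numbers such that no $b_j$ belongs to $\{0,-1,-2,\ldots\}$, let $\sigma\in\mathbb{C}$, and put $\psi=\sum_{k=1}^{q}(b_k-a_k)$. Let ${}_{q+1}F_q(\sigma,A;B;\cdot)$ denote the analytic continuation to $\mathbb{C}\setminus[1,\infty)$ of the sum of the series $$\sum_{n=0}^{\infty}\frac{(\sigma)_n(a_1)_n\cdots(a_q)_n}{(b_1)_n\cdots(b_q)_n\,n!}\,z^n\quad(|z|<1),\qquad (x)_n=x(x+1)\cdots(x+n-1).$$ We say that a function $\rho:[0,1]\to\mathbb{C}$ represents ${}_{q+1}F_q$ if $\rho$ is (Lebesgue) summable on $[0,1]$ and $${}_{q+1}F_q(\sigma,A;B;-z)=\int_0^1\frac{\rho(s)\,ds}{(1+sz)^{\sigma}}\qquad\text{for all } z\in\mathbb{C}\setminus(-\infty,-1],\ \text{i.e. } |\arg(1+z)|<\pi,$$ with the principal branch of the power. 1. (Criterion.) Assume that $\sigma\notin\{0,-1,-2,\ldots\}$ and that no $a_i$ with $\Re a_i\le 0$ is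 of the form $b_j+l$ with $1\le j\le q$ and $l\in\{0,1,2,\ldots\}$. Then a representing function $\rho$ exists if and only if $\Re a_i>0$ for $i=1,\ldots,q$ and $\Re\psi>0$. 2. (Necessity in the presence of coinciding parameters.) Assume only that $\sigma\notin\{0,-1,-2,\ldots\}$. If a representing function exists, then $\Re\psi>0$, and $\Re a_i>0$ for every $i$ such that $a_i-b_j\notin\{0,1,2,\ldots\}$ for all $j$. 3. (Formula for $\rho$.) Assume that $\Re a_i>0$ for $i=1,\ldots,q$ and $\Re\psi>0$; here $\sigma\in\mathbb{C}$ is arbitrary. Let $c>-\min_i\Re a_i$. Then for every $s\in(0,1)$ the limit $$G^{q,0}_{q,q}\!\left(s\left|\begin{array}{l}B\\A\end{array}\right.\right)=\lim_{R\to\infty}\frac{1}{2\pi i}\int_{c-iR}^{c+iR}\frac{\Gamma(a_1+t)\cdots\Gamma(a_q+t)}{\Gamma(b_1+t)\cdots\Gamma(b_q+t)}\,s^{-t}\,dt$$ exists, and the function $$\rho(s)=\left(\prod_{i=1}^{q}\frac{\Gamma(b_i)}{\Gamma(a_i)}\right)\frac1s\,G^{q,0}_{q,q}\!\left(s\left|\begin{array}{l}B\\A\end{array}\right.\right)$$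 represents ${}_{q+1}F_q$. If $\sigma\notin\{0,-1,-2,\ldots\}$, every representing function is equal to this $\rho$ almost everywhere on $[0,1]$. -/

import Mathlib

open Filter Topology MeasureTheory

noncomputable section

/-- The rising factorial `(x)_n = x (x + 1) ⋯ (x + n - 1)`. -/
def risingFactorial (x : ℂ) (n : ℕ) : ℂ := ∏ k ∈ Finset.range n, (x + k)

/-- The sum of the power series
`∑ (σ)_n (a_1)_n ⋯ (a_q)_n / ((b_1)_n ⋯ (b_q)_n n!) z ^ n`. -/
def hypSeries {q : ℕ} (σ : ℂ) (a b : Fin q → ℂ) (z : ℂ) : ℂ :=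
  ∑' n : ℕ, risingFactorial σ n * (∏ i, risingFactorial (a i) n) /
    ((∏ j, risingFactorial (b j) n) * (n.factorial : ℂ)) * z ^ n

/-- The plane cut along `[1, ∞)`: all `z` with `1 - z ≠ 0` and `|arg (1 - z)| < π`. -/
def cutPlane : Set ℂ := {z | 1 - z ∈ Complex.slitPlane}

/-- `f` is holomorphic in the plane cut along `[1, ∞)` and is equal to the sum of the
hypergeometric series in the unit disk. -/
def IsHypContinuation {q : ℕ} (σ : ℂ) (a b : Fin q → ℂ) (f : ℂ → ℂ) : Prop :=
  DifferentiableOn ℂ f cutPlane ∧ ∀ z : ℂ, ‖z‖ < 1 → f z = hypSeries σ a b z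

open Classical in
/-- The generalized hypergeometric function `_{q+1}F_q(σ, A; B; z)`: the analytic continuation of
the hypergeometric series to the plane cut along `[1, ∞)`. Values on the cut carry no meaning. -/
def hypF {q : ℕ} (σ : ℂ) (a b : Fin q → ℂ) (z : ℂ) : ℂ :=
  if h : ∃ f : ℂ → ℂ, IsHypContinuation σ a b f then h.choose z else hypSeries σ a b z

/-- `(2 π i)⁻¹ ∫ ∏ Γ(lo_j + s) / ∏ Γ(up_i + s) x ^ (-s) ds` over the segment from `c - i R` to
`c + i R`, parametrized by `s = c + i t`. -/
def meijerGTrunc {p q : ℕ} (c : ℝ) (up : Fin p → ℂ) (lo : Fin q → ℂ) (x : ℂ) (R : ℝ) : ℂ :=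
  (1 / (2 * (Real.pi : ℂ) * Complex.I)) *
    ∫ t in (-R)..R,
      (∏ j, Complex.Gamma (lo j + ((c : ℂ) + t * Complex.I))) /
        (∏ i, Complex.Gamma (up i + ((c : ℂ) + t * Complex.I))) *
        x ^ (-((c : ℂ) + t * Complex.I)) * Complex.I

/-- Meijer's function `G^{q,0}_{p,q}(x | up; lo)`, as the (improper) integral over the vertical
line `Re s = c`, to be used for `c > - min_j Re lo_j`. -/
def meijerG {p q : ℕ} (c : ℝ) (up : Fin p → ℂ) (lo : Fin q → ℂ) (x : ℂ) : ℂ :=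
  limUnder atTop (meijerGTrunc c up lo x)

/-- `ρ(s) = ∏ (Γ(b_i) / Γ(a_i)) s⁻¹ G^{q,0}_{q,q}(s | B; A)`. -/
def hypDensity {q : ℕ} (c : ℝ) (a b : Fin q → ℂ) (s : ℝ) : ℂ :=
  (∏ i, Complex.Gamma (b i) / Complex.Gamma (a i)) * (1 / (s : ℂ)) * meijerG c b a (s : ℂ)

/-- `ρ` is summable on `[0, 1]` and `_{q+1}F_q(σ, A; B; -z) = ∫₀¹ ρ(s) (1 + s z) ^ (-σ) ds` for
all `z` with `|arg (1 + z)| < π` (and `1 + z ≠ 0`). -/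
def IsRepresentedBy {q : ℕ} (σ : ℂ) (a b : Fin q → ℂ) (ρ : ℝ → ℂ) : Prop :=
  IntegrableOn ρ (Set.Icc 0 1) volume ∧
    ∀ z : ℂ, 1 + z ∈ Complex.slitPlane →
      hypF σ a b (-z) = ∫ s in (0 : ℝ)..1, ρ s / (1 + (s : ℂ) * z) ^ σ

/-- `ψ = ∑ (b_k - a_k)`. -/
def hypPsi {q : ℕ} (a b : Fin q → ℂ) : ℂ := ∑ k, (b k - a k)

end

/-! ### One step `u → u + 1` of the Gamma recurrence: a factor `1 + O(|u + 2|⁻²)`. -/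

section GammaQuotient

open Complex Asymptotics

/-! Expanding `(1 - s z) ^ (-σ)` in the binomial series and integrating termwise turns the
representation into a Hausdorff moment problem: it holds once `∫ s ^ n ρ(s) ds = hypMoment a b n`
for all `n`, and, if no `(σ)_n` vanishes, only then (`isRepresentedBy_of_moments`,
`IsRepresentedBy.moments`). By Weierstrass approximation the moments determine a summable `ρ` almost
everywhere (`ae_eq_of_moments_eq`).

Sufficiency. Up to a constant, the moments are the values at `w = n` of `gammaProd a b w`, which is
`O(|w| ^ (-Re ψ))` in the right half-plane, so the density should be its inverse Mellin transform.
For `Re ψ ≤ 1` this bound does not make that integral absolutely convergent. Multiplying the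
transform by `1 - s` replaces `f w` by `f w - f (w + 1)`, which gains one power of decay and is
integrable for every `Re ψ > 0`. The resulting `differenceTransform` vanishes at `s = 1` with a
Hölder bound, so dividing by `1 - s` leaves a summable function. Fubini and Cauchy's formula give
the Mellin transform of `differenceTransform`, and a telescoping argument gives that of the quotient
(`IsMellinSymbol.integral_cpow_mul_div`).

Necessity. Moments of a summable function tend to zero, while `hypMoment a b n` behaves like a
nonzero constant times `n ^ (-ψ)`; hence `Re ψ > 0`. Next, the Mellin transform of `ρ` is bounded
and holomorphic for `Re w > 0` and agrees there with a multiple of `gammaProd`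
(`unitMellin_mul_prod_eq`). If `Re a_i ≤ 0`, the pole of `Γ(a_i + w)` at `w = -a_i` must therefore
be cancelled by a zero of some `1 / Γ(b_j + w)`, which forces `a_i - b_j ∈ {0, 1, 2, …}`
(`re_pos_of_moments`). -/

theorem Complex.log_add_one_sub_log {w : ℂ} (hw : 0 < w.re) :
    log (w + 1) - log w = log (1 + w⁻¹) := by
  have hw0 : w ≠ 0 := by rintro rfl; simp at hw
  have hinv : 0 < (w⁻¹).re := by
    rw [Complex.inv_re]; exact div_pos hw (normSq_pos.2 hw0)
  have h1 : 0 < (1 + w⁻¹).re := by simp only [add_re, one_re]; linarith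
  have h10 : 1 + w⁻¹ ≠ 0 := fun h => by rw [h] at h1; simp at h1
  have e : w + 1 = w * (1 + w⁻¹) := by field_simp
  have a1 := abs_lt.1 (abs_arg_lt_pi_div_two_iff.2 (Or.inl hw))
  have a2 := abs_lt.1 (abs_arg_lt_pi_div_two_iff.2 (Or.inl h1))
  rw [e, log_mul hw0 h10 ⟨by linarith [a1.1, a2.1], by linarith [a1.2, a2.2]⟩]
  ring

theorem le_norm_add_of_re_nonneg {u : ℂ} (hu : 0 ≤ u.re) (x : ℝ) :
    x ≤ ‖u + x‖ := by
  refine le_trans ?_ ((le_abs_self _).trans (abs_re_le_norm _))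
  simp; exact hu

theorem isBigO_inv_add {a : ℂ} (ha : 0 < a.re) :
    (fun u : ℂ => (u + a)⁻¹) =O[𝓟 {u | 0 ≤ u.re}] (fun u : ℂ => (u + 2)⁻¹) := by
  rw [isBigO_principal]
  refine ⟨1 + ‖2 - a‖ / a.re, fun u hu => ?_⟩
  have hu : 0 ≤ u.re := hu
  have h1 : a.re ≤ ‖u + a‖ := by
    refine le_trans ?_ ((le_abs_self _).trans (abs_re_le_norm _))
    simp; exact hu
  have h2 : 0 < ‖u + 2‖ := by
    have := le_norm_add_of_re_nonneg hu 2
    push_cast at this; linarith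
  have h3 : 0 < ‖u + a‖ := by linarith
  rw [norm_inv, norm_inv, ← div_eq_mul_inv, le_div_iff₀ h2, inv_mul_le_iff₀ h3]
  have h4 : ‖u + 2‖ ≤ ‖u + a‖ + ‖2 - a‖ := by
    have := norm_add_le (u + a) (2 - a)
    rwa [show u + a + (2 - a) = u + 2 by ring] at this
  have h5 : ‖2 - a‖ ≤ ‖u + a‖ * (‖2 - a‖ / a.re) := by
    rw [mul_div_assoc', le_div_iff₀ ha, mul_comm]
    exact mul_le_mul_of_nonneg_right h1 (norm_nonneg _)
  nlinarith

theorem isBigO_log_add_one_sub_log :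
    (fun u : ℂ => log (u + 3) - log (u + 2) - (u + 2)⁻¹) =O[𝓟 {u | 0 ≤ u.re}]
      (fun u : ℂ => (u + 2)⁻¹ ^ 2) := by
  rw [isBigO_principal]
  refine ⟨1, fun u hu => ?_⟩
  have hu : 0 ≤ u.re := hu
  have h2 := le_norm_add_of_re_nonneg hu 2
  push_cast at h2
  -- The shift by `2` keeps the argument of the logarithm series at most `1/2` up to the boundary of
  -- the half-plane, including `u = 0`.
  have h3 : ‖(u + 2)⁻¹‖ ≤ 1 / 2 := by
    rw [norm_inv, one_div]; exact inv_anti₀ (by norm_num) h2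
  have e : u + 3 = (u + 2) + 1 := by ring
  rw [e, log_add_one_sub_log (by simp; linarith)]
  refine (norm_log_one_add_sub_self_le (by linarith)).trans ?_
  rw [norm_pow, one_mul, mul_div_assoc]
  refine mul_le_of_le_one_right (by positivity) ?_
  have : (1 - ‖(u + 2)⁻¹‖)⁻¹ ≤ (1 / 2)⁻¹ := inv_anti₀ (by norm_num) (by linarith)
  linarith [this, show ((1 : ℝ) / 2)⁻¹ = 2 by norm_num]

theorem isBigO_inv_add_two_one :
    (fun u : ℂ => (u + 2)⁻¹) =O[𝓟 {u | 0 ≤ u.re}] (fun _ : ℂ => (1 : ℂ)) := by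
  rw [isBigO_principal]
  refine ⟨1, fun u hu => ?_⟩
  have h2 := le_norm_add_of_re_nonneg (u := u) hu 2
  push_cast at h2
  rw [norm_inv, norm_one, mul_one]
  exact inv_le_one_of_one_le₀ (by linarith)

/-- The quotient is `1 + (b - a) / (u + 2)` and the exponential is `1 - (b - a) / (u + 2)`, both up
to `O(|u + 2|⁻²)`. The first-order terms cancel; this is why the Gamma quotient is normalized by the
power `b - a`. -/
theorem isBigO_gammaStep {a b : ℂ} (ha : 0 < a.re) :
    (fun u : ℂ => (u + b) / (u + a) * exp (-((b - a) * (log (u + 3) - log (u + 2)))) - 1)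
      =O[𝓟 {u | 0 ≤ u.re}] (fun u : ℂ => (u + 2)⁻¹ ^ 2) := by
  set l := 𝓟 {u : ℂ | 0 ≤ u.re}
  set z : ℂ → ℂ := fun u => (u + 2)⁻¹
  set L : ℂ → ℂ := fun u => log (u + 3) - log (u + 2)
  have hz1 : z =O[l] (fun _ => (1 : ℂ)) := isBigO_inv_add_two_one
  have hzz : (fun u => z u ^ 2) =O[l] z := by
    simpa [sq] using (isBigO_refl z l).mul hz1
  have hL0 : (fun u => L u - z u) =O[l] (fun u => z u ^ 2) := isBigO_log_add_one_sub_log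
  have hL : L =O[l] z := by
    simpa using (hL0.trans hzz).add (isBigO_refl z l)
  set x : ℂ → ℂ := fun u => (b - a) * (u + a)⁻¹
  set v : ℂ → ℂ := fun u => -((b - a) * L u)
  have hv : v =O[l] z := (hL.const_mul_left (b - a)).neg_left
  have hx : x =O[l] z := (isBigO_inv_add ha).const_mul_left _
  have hx' : (fun u => x u - (b - a) * z u) =O[l] (fun u => z u ^ 2) := by
    have h1 : (fun u => (b - a) * (2 - a) * ((u + a)⁻¹ * z u)) =O[l] (fun u => z u ^ 2) := by
      simpa [sq] using (((isBigO_inv_add ha).mul (isBigO_refl z l)).const_mul_left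
        ((b - a) * (2 - a)))
    refine h1.congr' ?_ EventuallyEq.rfl
    filter_upwards [mem_principal_self _] with u hu
    have hu : 0 ≤ u.re := hu
    have e1 : u + a ≠ 0 := fun h => by
      have := congrArg re h; simp at this; linarith
    have e2 : u + 2 ≠ 0 := fun h => by
      have := congrArg re h; simp at this; linarith
    simp only [x, z]; field_simp; ring
  have hexp : (fun u => exp (v u) - 1 - v u) =O[l] (fun u => z u ^ 2) := by
    have h1 : (fun u => exp (v u) - 1 - v u) =O[l] (fun u => v u ^ 2) := by
      obtain ⟨c, hc⟩ := isBigO_principal.1 (hv.trans hz1)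
      refine isBigO_principal.2 ⟨Real.exp c, fun u hu => ?_⟩
      have h := norm_exp_sub_sum_le_norm_mul_exp (v u) 2
      simp only [Finset.sum_range_succ, Finset.sum_range_zero] at h
      simp only [pow_zero, Nat.factorial_zero, Nat.cast_one, div_one, zero_add, pow_one,
        Nat.factorial_one] at h
      rw [sub_sub, norm_pow, mul_comm]
      refine h.trans (mul_le_mul_of_nonneg_left (Real.exp_le_exp.2 ?_) (by positivity))
      simpa using hc u hu
    exact h1.trans (hv.pow 2)
  set y : ℂ → ℂ := fun u => exp (v u) - 1
  have hy' : (fun u => y u + (b - a) * z u) =O[l] (fun u => z u ^ 2) := by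
    refine (hexp.add (hL0.const_mul_left (-(b - a)))).congr_left fun u => ?_
    simp only [y, v]; ring
  have hy : y =O[l] z := by
    refine ((hexp.trans hzz).add hv).congr_left fun u => ?_
    simp only [y]; ring
  have hxy : (fun u => x u * y u) =O[l] (fun u => z u ^ 2) := by
    simpa [sq] using hx.mul hy
  refine ((hx'.add hy').add hxy).congr' ?_ EventuallyEq.rfl
  filter_upwards [mem_principal_self _] with u hu
  have hu : 0 ≤ u.re := hu
  have e1 : u + a ≠ 0 := fun h => by
    have := congrArg re h; simp at this; linarith
  have e3 : (u + b) / (u + a) = 1 + x u := by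
    simp only [x]; field_simp; ring
  rw [e3, show exp (-((b - a) * (log (u + 3) - log (u + 2)))) = 1 + y u by simp only [y, v, L]; ring]
  ring

end GammaQuotient

/-! ### Uniform growth of `Γ(u + a) / Γ(u + b)` in the right half-plane. -/

section GammaQuotient

open Complex Asymptotics

theorem Complex.Gamma_add_nat_eq_prod {s : ℂ} (hs : ∀ m : ℕ, s ≠ -m) (n : ℕ) :
    Gamma (s + n) = (∏ j ∈ Finset.range n, (s + j)) * Gamma s := by
  induction n with
  | zero => simp
  | succ n ih =>
    have : s + n ≠ 0 := fun h => hs n (eq_neg_of_add_eq_zero_left h)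
    rw [Nat.cast_succ, ← add_assoc, Gamma_add_one _ this, ih, Finset.prod_range_succ]; ring

theorem Complex.ne_neg_nat_of_re_pos {s : ℂ} (hs : 0 < s.re) (m : ℕ) : s ≠ -m := fun h => by
  have h1 := congrArg re h
  simp only [neg_re, natCast_re] at h1
  have : (0 : ℝ) ≤ m := m.cast_nonneg
  linarith

/-- Quotient of two instances of Euler's limit formula; the factorials cancel. -/
theorem prod_gammaSeq_denominators_tendsto {s t : ℂ} (hs : ∀ m : ℕ, s ≠ -m) :
    Tendsto (fun n : ℕ => (∏ j ∈ Finset.range (n + 1), (s + j)) /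
      (∏ j ∈ Finset.range (n + 1), (t + j)) * (n : ℂ) ^ (t - s)) atTop
      (𝓝 (Gamma t / Gamma s)) := by
  refine ((GammaSeq_tendsto_Gamma t).div (GammaSeq_tendsto_Gamma s)
    (Gamma_ne_zero hs)).congr' ?_
  filter_upwards [eventually_gt_atTop 0] with n hn
  have hn' : (n : ℂ) ≠ 0 := by exact_mod_cast hn.ne'
  have h1 : (n.factorial : ℂ) ≠ 0 := by exact_mod_cast n.factorial_ne_zero
  have h2 : (n : ℂ) ^ s ≠ 0 := by simp [cpow_eq_zero_iff, hn']
  simp only [Pi.div_apply, GammaSeq]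
  rw [cpow_sub _ _ hn']
  field_simp

theorem Gamma_add_div_tendsto {a b : ℂ} (ha : 0 < a.re) (hb : 0 < b.re) :
    Tendsto (fun n : ℕ => Gamma (a + (n + 1 : ℕ)) / Gamma (b + (n + 1 : ℕ)) *
      (n : ℂ) ^ (b - a)) atTop (𝓝 1) := by
  have ha' := ne_neg_nat_of_re_pos ha
  have hb' := ne_neg_nat_of_re_pos hb
  have hga := Gamma_ne_zero ha'
  have hgb := Gamma_ne_zero hb'
  have h := (prod_gammaSeq_denominators_tendsto (s := a) (t := b) ha').const_mul
    (Gamma a / Gamma b)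
  rw [show Gamma a / Gamma b * (Gamma b / Gamma a) = 1 by field_simp] at h
  refine h.congr fun n => ?_
  rw [Gamma_add_nat_eq_prod ha', Gamma_add_nat_eq_prod hb', mul_comm _ (Gamma a),
    mul_comm _ (Gamma b), mul_div_mul_comm]
  ring

theorem log_add_sub_log_natCast_tendsto (x : ℂ) :
    Tendsto (fun n : ℕ => log (n + x) - log (n : ℂ)) atTop (𝓝 0) := by
  have h1 : Tendsto (fun n : ℕ => 1 + x / (n : ℂ)) atTop (𝓝 1) := by
    simpa [div_eq_mul_inv] using (((tendsto_inv₀_cobounded (α := ℂ)).comp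
      tendsto_natCast_atTop_cobounded).const_mul x).const_add 1
  have h2 : Tendsto (fun n : ℕ => log (1 + x / (n : ℂ))) atTop (𝓝 0) := by
    have := (continuousAt_clog (x := 1) (by simp)).tendsto.comp h1
    simpa [Function.comp_def] using this
  refine h2.congr' ?_
  filter_upwards [eventually_gt_atTop 0, h1.eventually_ne one_ne_zero] with n hn hne
  have hn' : (n : ℂ) ≠ 0 := by exact_mod_cast hn.ne'
  have hn0 : (0 : ℝ) < n := by exact_mod_cast hn
  have e : (n : ℂ) + x = ((n : ℝ) : ℂ) * (1 + x / n) := by push_cast; field_simp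
  rw [e, log_ofReal_mul hn0 hne, ofReal_log hn0.le]
  push_cast; ring

/-- The quotient `Γ(u + a) / Γ(u + b)` multiplied by `(u + 2) ^ (b - a)`. -/
noncomputable def normalizedGammaQuotient (a b u : ℂ) : ℂ :=
  Gamma (u + a) / Gamma (u + b) * exp ((b - a) * log (u + 2))

theorem normalizedGammaQuotient_step {a b u : ℂ} (ha : u + a ≠ 0) :
    normalizedGammaQuotient a b u = normalizedGammaQuotient a b (u + 1) *
      ((u + b) / (u + a) * exp (-((b - a) * (log (u + 3) - log (u + 2))))) := by
  unfold normalizedGammaQuotient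
  have h1 : Gamma (u + 1 + a) = (u + a) * Gamma (u + a) := by
    rw [add_right_comm, Gamma_add_one _ ha]
  have h2 : (Gamma (u + b))⁻¹ = (u + b) * (Gamma (u + 1 + b))⁻¹ := by
    rw [add_right_comm, one_div_Gamma_eq_self_mul_one_div_Gamma_add_one]
  have h3 : exp ((b - a) * log (u + 2)) = exp ((b - a) * log (u + 1 + 2)) *
      exp (-((b - a) * (log (u + 3) - log (u + 2)))) := by
    rw [← exp_add, show u + 1 + 2 = u + 3 by ring]; ring_nf
  rw [div_eq_mul_inv, h2, h1, h3]
  field_simp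

theorem normalizedGammaQuotient_tendsto {a b : ℂ} (ha : 0 < a.re) (hb : 0 < b.re) {u : ℂ}
    (hu : 0 ≤ u.re) :
    Tendsto (fun n : ℕ => normalizedGammaQuotient a b (u + (n + 1 : ℕ))) atTop (𝓝 1) := by
  have h1 := Gamma_add_div_tendsto (a := u + a) (b := u + b) (by simp; linarith)
    (by simp; linarith)
  have h2 : Tendsto (fun n : ℕ => exp ((b - a) * (log (n + (u + 3)) - log (n : ℂ)))) atTop
      (𝓝 1) := by
    have := (continuous_exp.tendsto _).comp
      ((log_add_sub_log_natCast_tendsto (u + 3)).const_mul (b - a))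
    simpa [Function.comp_def] using this
  have h3 := h1.mul h2
  rw [mul_one] at h3
  refine h3.congr' ?_
  filter_upwards [eventually_gt_atTop 0] with n hn
  have hn' : (n : ℂ) ≠ 0 := by exact_mod_cast hn.ne'
  unfold normalizedGammaQuotient
  rw [cpow_def_of_ne_zero hn', mul_assoc, ← exp_add]
  push_cast
  ring_nf

/-- The subtracted `(n + 1)⁻¹` lets the induction telescope. -/
theorem sum_inv_sq_le_one (n : ℕ) :
    ∑ k ∈ Finset.range n, (((k : ℝ) + 2)⁻¹) ^ 2 ≤ 1 - ((n : ℝ) + 1)⁻¹ := by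
  induction n with
  | zero => simp
  | succ n ih =>
    rw [Finset.sum_range_succ]
    have h : (((n : ℝ) + 2)⁻¹) ^ 2 ≤ ((n : ℝ) + 1)⁻¹ - ((n : ℝ) + 2)⁻¹ := by
      have h1 : (0 : ℝ) < n + 1 := by positivity
      have h2 : (0 : ℝ) < n + 2 := by positivity
      rw [inv_sub_inv h1.ne' h2.ne', inv_pow, show (n : ℝ) + 2 - (n + 1) = 1 by ring, one_div]
      exact inv_anti₀ (by positivity) (by nlinarith)
    push_cast
    rw [show (n : ℝ) + 1 + 1 = n + 2 by ring]
    linarith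

/-- Iterating the recurrence expresses the value at `u` through the value at `u + n`, which tends to
`1`, and a product of factors `1 + ε (u + k)`. As `|u + k + 2| ≥ k + 2` throughout the half-plane,
the sum of the `‖ε (u + k)‖` is at most `|c|`, and the product is at most `exp |c|` uniformly in
`u`. -/
theorem exists_norm_normalizedGammaQuotient_le {a b : ℂ} (ha : 0 < a.re) (hb : 0 < b.re) :
    ∃ C, ∀ u : ℂ, 0 ≤ u.re → ‖normalizedGammaQuotient a b u‖ ≤ C := by
  obtain ⟨c, hc⟩ := isBigO_principal.1 (isBigO_gammaStep (b := b) ha)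
  refine ⟨Real.exp (|c|), fun u hu => ?_⟩
  set ε : ℂ → ℂ := fun u =>
    (u + b) / (u + a) * exp (-((b - a) * (log (u + 3) - log (u + 2)))) - 1
  have hre : ∀ k : ℕ, 0 ≤ (u + k).re := fun k => by
    simp only [add_re, natCast_re]; positivity
  have hstep : ∀ n : ℕ, normalizedGammaQuotient a b u =
      normalizedGammaQuotient a b (u + n) * ∏ k ∈ Finset.range n, (1 + ε (u + k)) := by
    intro n
    induction n with
    | zero => simp
    | succ n ih =>
      rw [ih, normalizedGammaQuotient_step (u := u + n), Finset.prod_range_succ]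
      · push_cast
        rw [← add_assoc]
        simp only [ε]; ring
      · intro h
        have := congrArg re h
        have h2 := hre n
        simp only [add_re, zero_re] at this h2; linarith
  have hε : ∀ k : ℕ, ‖ε (u + k)‖ ≤ |c| * (((k : ℝ) + 2)⁻¹) ^ 2 := by
    intro k
    refine (hc _ (hre k)).trans ?_
    rw [norm_pow, norm_inv]
    have h2 : (k : ℝ) + 2 ≤ ‖u + k + 2‖ := by
      have := le_norm_add_of_re_nonneg hu ((k : ℝ) + 2)
      push_cast at this
      rwa [← add_assoc] at this
    refine mul_le_mul (le_abs_self c) ?_ (by positivity) (abs_nonneg c)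
    exact pow_le_pow_left₀ (by positivity) (inv_anti₀ (by positivity) h2) 2
  have hprod : ∀ n : ℕ, ‖∏ k ∈ Finset.range n, (1 + ε (u + k))‖ ≤ Real.exp |c| := by
    intro n
    have h1 := Finset.norm_prod_one_add_sub_one_le (Finset.range n) fun k : ℕ => ε (u + k)
    have h2 : ∑ k ∈ Finset.range n, ‖ε (u + k)‖ ≤ |c| := by
      refine (Finset.sum_le_sum fun k _ => hε k).trans ?_
      rw [← Finset.mul_sum]
      refine mul_le_of_le_one_right (abs_nonneg c) ((sum_inv_sq_le_one n).trans ?_)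
      have : 0 ≤ ((n : ℝ) + 1)⁻¹ := by positivity
      linarith
    have h3 := norm_sub_norm_le (∏ k ∈ Finset.range n, (1 + ε (u + k))) 1
    rw [norm_one] at h3
    linarith [Real.exp_le_exp.2 h2]
  have hlim := (normalizedGammaQuotient_tendsto ha hb hu).norm.mul_const (Real.exp |c|)
  rw [norm_one, one_mul] at hlim
  refine ge_of_tendsto' hlim fun n => ?_
  rw [hstep (n + 1), norm_mul]
  exact mul_le_mul_of_nonneg_left (hprod _) (norm_nonneg _)

theorem exists_norm_Gamma_div_le_of_re_pos {a b : ℂ} (ha : 0 < a.re) (hb : 0 < b.re) :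
    ∃ C, 0 ≤ C ∧ ∀ u : ℂ, 0 ≤ u.re →
      ‖Gamma (u + a) / Gamma (u + b)‖ ≤ C * ‖u + 2‖ ^ (a - b).re := by
  obtain ⟨C, hC⟩ := exists_norm_normalizedGammaQuotient_le ha hb
  have hC0 : 0 ≤ C := (norm_nonneg _).trans (hC 0 le_rfl)
  -- The exponential bounds the factor by which the argument of `u + 2` enters the modulus of `(u +
  -- 2) ^ (a - b)`.
  refine ⟨C * Real.exp (Real.pi * |(a - b).im|), by positivity, fun u hu => ?_⟩
  have h2 : u + 2 ≠ 0 := fun h => by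
    have := congrArg re h
    simp at this; linarith
  have e : Gamma (u + a) / Gamma (u + b) =
      normalizedGammaQuotient a b u * (u + 2) ^ (a - b) := by
    rw [cpow_def_of_ne_zero h2, normalizedGammaQuotient, mul_assoc, ← exp_add]
    rw [show (b - a) * log (u + 2) + log (u + 2) * (a - b) = 0 by ring]
    simp
  rw [e, norm_mul, norm_cpow_of_ne_zero h2, mul_assoc, div_eq_mul_inv, ← Real.exp_neg,
    mul_comm (‖u + 2‖ ^ (a - b).re)]
  refine mul_le_mul (hC u hu) (mul_le_mul_of_nonneg_right (Real.exp_le_exp.2 ?_)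
    (by positivity)) (by positivity) hC0
  refine (neg_le_abs _).trans ?_
  rw [abs_mul]
  exact mul_le_mul_of_nonneg_right (abs_arg_le_pi _) (abs_nonneg _)

/-- For `Re b ≤ 0`, the identity `1 / Γ(z) = z / Γ(z + 1)`, valid also at the poles, raises `b` by
one at the cost of a factor `|u + b| = O(|u + 2|)`, exactly what the exponent allows. -/
theorem exists_norm_Gamma_div_le {a : ℂ} (b : ℂ) (ha : 0 < a.re) :
    ∃ C, 0 ≤ C ∧ ∀ u : ℂ, 0 ≤ u.re →
      ‖Gamma (u + a) / Gamma (u + b)‖ ≤ C * ‖u + 2‖ ^ (a - b).re := by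
  obtain ⟨m, hm⟩ : ∃ m : ℕ, 0 < (b + m).re :=
    (exists_nat_gt (-b.re)).imp fun m hm => by simp; linarith
  induction m generalizing b with
  | zero => exact exists_norm_Gamma_div_le_of_re_pos ha (by simpa using hm)
  | succ m ih =>
    obtain ⟨C, hC0, hC⟩ := ih (b + 1) (by
      push_cast at hm; rwa [add_right_comm, add_assoc])
    refine ⟨C * (1 + ‖b - 2‖), by positivity, fun u hu => ?_⟩
    have h2 := le_norm_add_of_re_nonneg hu 2
    push_cast at h2
    have e : Gamma (u + a) / Gamma (u + b) =
        Gamma (u + a) / Gamma (u + (b + 1)) * (u + b) := by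
      rw [div_eq_mul_inv, one_div_Gamma_eq_self_mul_one_div_Gamma_add_one, ← add_assoc]; ring
    have h3 : ‖u + b‖ ≤ (1 + ‖b - 2‖) * ‖u + 2‖ := by
      have := norm_add_le (u + 2) (b - 2)
      rw [show u + 2 + (b - 2) = u + b by ring] at this
      nlinarith [norm_nonneg (b - 2)]
    have h4 : ‖u + 2‖ ^ (a - b).re = ‖u + 2‖ ^ (a - (b + 1)).re * ‖u + 2‖ := by
      nth_rewrite 3 [← Real.rpow_one ‖u + 2‖]
      rw [← Real.rpow_add (by linarith)]
      simp only [sub_re, add_re, one_re]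
      ring_nf
    rw [e, norm_mul, h4]
    calc _ ≤ (C * ‖u + 2‖ ^ (a - (b + 1)).re) * ((1 + ‖b - 2‖) * ‖u + 2‖) :=
          mul_le_mul (hC u hu) h3 (norm_nonneg _) (by positivity)
      _ = _ := by ring

end GammaQuotient

/-! ### Products of Gamma quotients and their differences. -/

section GammaProduct

open Complex

/-- Functions holomorphic in a neighbourhood of the closed right half-plane, of order `|w| ^ (-p)`
there, and with differences `f w - f (w + 1)` of order `|w| ^ (-p - 1)`. -/
structure IsMellinSymbol (f : ℂ → ℂ) (p : ℝ) : Prop where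
  differentiableOn : ∃ δ : ℝ, 0 < δ ∧ DifferentiableOn ℂ f {w | -δ < w.re}
  norm_le : ∃ C : ℝ, 0 ≤ C ∧ ∀ w : ℂ, 0 ≤ w.re → ‖f w‖ ≤ C * ‖w + 2‖ ^ (-p)
  norm_sub_le : ∃ C : ℝ, 0 ≤ C ∧
    ∀ w : ℂ, 0 ≤ w.re → ‖f w - f (w + 1)‖ ≤ C * ‖w + 2‖ ^ (-(p + 1))

/-- The product `∏ Γ(a_i + w) / ∏ Γ(b_i + w)`. -/
noncomputable def gammaProd {q : ℕ} (a b : Fin q → ℂ) (w : ℂ) : ℂ :=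
  (∏ i, Gamma (a i + w)) / ∏ i, Gamma (b i + w)

variable {q : ℕ} {a : Fin q → ℂ}

theorem exists_pos_lt_re (ha : ∀ i, 0 < (a i).re) : ∃ δ : ℝ, 0 < δ ∧ ∀ i, δ < (a i).re := by
  have h : ∀ᶠ δ : ℝ in 𝓝[>] 0, ∀ i, δ < (a i).re :=
    eventually_all.2 fun i => nhdsWithin_le_nhds (eventually_lt_nhds (ha i))
  obtain ⟨δ, h1, h2⟩ := (h.and self_mem_nhdsWithin).exists
  exact ⟨δ, h2, h1⟩

theorem differentiableAt_gammaProd (b : Fin q → ℂ) {w : ℂ} (h : ∀ i, 0 < (a i + w).re) :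
    DifferentiableAt ℂ (gammaProd a b) w := by
  have e : gammaProd a b = fun w => (∏ i, Gamma (a i + w)) * ∏ i, (Gamma (b i + w))⁻¹ := by
    funext w; simp [gammaProd, div_eq_mul_inv]
  rw [e]
  refine DifferentiableAt.mul ?_ ?_
  · refine DifferentiableAt.fun_finsetProd fun i _ => ?_
    exact (differentiableAt_Gamma _ (ne_neg_nat_of_re_pos (h i))).comp w
      (differentiableAt_id.const_add (a i))
  · refine DifferentiableAt.fun_finsetProd fun i _ => ?_
    exact (differentiable_one_div_Gamma (b i + w)).comp w (differentiableAt_id.const_add (b i))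

theorem exists_norm_gammaProd_le (ha : ∀ i, 0 < (a i).re) (b : Fin q → ℂ) :
    ∃ C : ℝ, 0 ≤ C ∧ ∀ w : ℂ, 0 ≤ w.re →
      ‖gammaProd a b w‖ ≤ C * ‖w + 2‖ ^ (-(hypPsi a b).re) := by
  choose C hC0 hC using fun i => exists_norm_Gamma_div_le (b i) (ha i)
  refine ⟨∏ i, C i, Finset.prod_nonneg fun i _ => hC0 i, fun w hw => ?_⟩
  have h2 := le_norm_add_of_re_nonneg hw 2
  push_cast at h2
  have e : -(hypPsi a b).re = ∑ i, (a i - b i).re := by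
    simp [hypPsi]
  rw [e, Real.rpow_sum_of_pos (by linarith), ← Finset.prod_mul_distrib, gammaProd,
    ← Finset.prod_div_distrib, norm_prod]
  refine Finset.prod_le_prod (fun i _ => norm_nonneg _) fun i _ => ?_
  rw [add_comm (a i), add_comm (b i)]
  exact hC i w hw

theorem gammaProd_eq_gammaProd_add_one_mul (b : Fin q → ℂ) {w : ℂ} (h : ∀ i, a i + w ≠ 0) :
    gammaProd a b w = gammaProd a b (w + 1) * ∏ i, ((b i + w) / (a i + w)) := by
  rw [gammaProd, gammaProd, ← Finset.prod_div_distrib, ← Finset.prod_div_distrib,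
    ← Finset.prod_mul_distrib]
  refine Finset.prod_congr rfl fun i _ => ?_
  rw [← add_assoc, ← add_assoc, Gamma_add_one _ (h i), div_eq_mul_inv,
    one_div_Gamma_eq_self_mul_one_div_Gamma_add_one]
  have := h i
  field_simp

/-- This is the relative difference between `gammaProd a b w` and `gammaProd a b (w + 1)`, hence the
source of the extra power in `norm_sub_le`. Each factor is `1 + O(|w + 2|⁻¹)`. -/
theorem exists_norm_prod_div_sub_one_le (ha : ∀ i, 0 < (a i).re) (b : Fin q → ℂ) :
    ∃ C : ℝ, 0 ≤ C ∧ ∀ w : ℂ, 0 ≤ w.re →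
      ‖(∏ i, ((b i + w) / (a i + w))) - 1‖ ≤ C * ‖w + 2‖⁻¹ := by
  choose c hc using fun i => Asymptotics.isBigO_principal.1 (isBigO_inv_add (ha i))
  set K := ∑ i, ‖b i - a i‖ * |c i|
  have hK : 0 ≤ K := Finset.sum_nonneg fun i _ => by positivity
  refine ⟨K * Real.exp K, by positivity, fun w hw => ?_⟩
  have h2 := le_norm_add_of_re_nonneg hw 2
  push_cast at h2
  have e : ∀ i, (b i + w) / (a i + w) = 1 + (b i - a i) * (w + a i)⁻¹ := fun i => by
    have : w + a i ≠ 0 := fun h => by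
      have h1 := congrArg re h
      have := ha i
      simp at h1; linarith
    rw [add_comm (a i)]; field_simp; ring
  simp only [e]
  refine (Finset.norm_prod_one_add_sub_one_le _ _).trans ?_
  have hS : ∑ i, ‖(b i - a i) * (w + a i)⁻¹‖ ≤ K * ‖w + 2‖⁻¹ := by
    rw [Finset.sum_mul]
    refine Finset.sum_le_sum fun i _ => ?_
    rw [norm_mul, mul_assoc]
    refine mul_le_mul_of_nonneg_left ?_ (norm_nonneg _)
    have := hc i w hw
    rw [norm_inv (w + 2)] at this
    exact this.trans (mul_le_mul_of_nonneg_right (le_abs_self _) (by positivity))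
  set S := K * ‖w + 2‖⁻¹ with hSdef
  have hSK : S ≤ K := mul_le_of_le_one_right hK (inv_le_one_of_one_le₀ (by linarith))
  -- This is `1 - S ≤ exp (-S)` multiplied by `exp S`.
  have h3 : Real.exp S - 1 ≤ S * Real.exp S := by
    have h4 := Real.add_one_le_exp (-S)
    have h5 : Real.exp S * Real.exp (-S) = 1 := by rw [← Real.exp_add]; simp
    nlinarith [Real.exp_pos S]
  have hS0 : 0 ≤ S := by positivity
  calc _ ≤ Real.exp S - 1 := by linarith [Real.exp_le_exp.2 hS]
    _ ≤ S * Real.exp S := h3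
    _ ≤ S * Real.exp K := mul_le_mul_of_nonneg_left (Real.exp_le_exp.2 hSK) hS0
    _ = _ := by rw [hSdef]; ring

theorem isMellinSymbol_gammaProd {b : Fin q → ℂ} (ha : ∀ i, 0 < (a i).re)
    (hψ : 0 < (hypPsi a b).re) : IsMellinSymbol (gammaProd a b) (hypPsi a b).re where
  differentiableOn := by
    obtain ⟨δ, hδ, hδa⟩ := exists_pos_lt_re ha
    refine ⟨δ, hδ, fun w hw => (differentiableAt_gammaProd b fun i => ?_).differentiableWithinAt⟩
    have := hδa i
    have hw : -δ < w.re := hw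
    simp only [add_re]; linarith
  norm_le := exists_norm_gammaProd_le ha b
  norm_sub_le := by
    obtain ⟨C, hC0, hC⟩ := exists_norm_gammaProd_le ha b
    obtain ⟨K, hK0, hK⟩ := exists_norm_prod_div_sub_one_le ha b
    refine ⟨C * K, by positivity, fun w hw => ?_⟩
    have h2 := le_norm_add_of_re_nonneg hw 2
    push_cast at h2
    have hne : ∀ i, a i + w ≠ 0 := fun i h => by
      have h1 := congrArg re h
      have := ha i
      simp at h1; linarith
    have hw1 : 0 ≤ (w + 1).re := by simp; linarith
    have hmono : ‖w + 2‖ ≤ ‖w + 1 + 2‖ := by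
      rw [← sq_le_sq₀ (norm_nonneg _) (norm_nonneg _), ← normSq_eq_norm_sq, ← normSq_eq_norm_sq,
        normSq_apply, normSq_apply]
      simp; nlinarith
    have h3 : ‖gammaProd a b (w + 1)‖ ≤ C * ‖w + 2‖ ^ (-(hypPsi a b).re) :=
      (hC _ hw1).trans (mul_le_mul_of_nonneg_left
        (Real.rpow_le_rpow_of_nonpos (by linarith) hmono (by linarith)) hC0)
    rw [gammaProd_eq_gammaProd_add_one_mul b hne, ← mul_sub_one, norm_mul, neg_add,
      Real.rpow_add (by linarith), Real.rpow_neg_one]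
    calc _ ≤ (C * ‖w + 2‖ ^ (-(hypPsi a b).re)) * (K * ‖w + 2‖⁻¹) :=
          mul_le_mul h3 (hK w hw) (norm_nonneg _) (by positivity)
      _ = _ := by ring

end GammaProduct

/-! ### Moving vertical lines of integration. -/

section ContourShift

open Complex

/-- Cauchy's theorem on the rectangle with opposite corners `-i R` and `h + i R`. -/
theorem I_mul_vertical_integral_sub {F : ℂ → ℂ} {δ : ℝ} (hδ : 0 < δ)
    (hF : DifferentiableOn ℂ F {w | -δ < w.re}) {h : ℝ} (hh : 0 ≤ h) (R : ℝ) :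
    I * ((∫ y in (-R)..R, F (y * I)) - ∫ y in (-R)..R, F (h + y * I)) =
      (∫ x in (0 : ℝ)..h, F (x + (-R : ℝ) * I)) - ∫ x in (0 : ℝ)..h, F (x + R * I) := by
  have := integral_boundary_rect_eq_zero_of_differentiableOn F ((-R : ℝ) * I) (h + R * I)
    (hF.mono fun w hw => ?_)
  · simp only [add_re, mul_re, ofReal_re, ofReal_im, I_re, I_im, mul_zero, add_im, mul_im, mul_one, zero_add, add_zero, smul_eq_mul, ofReal_zero, sub_self] at this
    linear_combination -this
  · have h1 := (mem_reProdIm.1 hw).1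
    simp only [add_re, mul_re, ofReal_re, ofReal_im, I_re, I_im, mul_zero, zero_mul,
      add_zero, sub_self] at h1
    rw [Set.uIcc_of_le hh] at h1
    exact lt_of_lt_of_le (by linarith) h1.1

theorem norm_vertical_integral_sub_le {F : ℂ → ℂ} {δ : ℝ} (hδ : 0 < δ)
    (hF : DifferentiableOn ℂ F {w | -δ < w.re}) {h : ℝ} (hh : 0 ≤ h) {R B : ℝ}
    (hB : ∀ w : ℂ, 0 ≤ w.re → w.re ≤ h → |w.im| = |R| → ‖F w‖ ≤ B) :
    ‖(∫ y in (-R)..R, F (y * I)) - ∫ y in (-R)..R, F (h + y * I)‖ ≤ 2 * (h * B) := by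
  have h1 := congrArg norm (I_mul_vertical_integral_sub hδ hF hh R)
  rw [norm_mul, norm_I, one_mul] at h1
  have key : ∀ r : ℝ, |r| = |R| → ‖∫ x in (0 : ℝ)..h, F (x + r * I)‖ ≤ B * |h - 0| := fun r hr => by
    refine intervalIntegral.norm_integral_le_of_norm_le_const fun x hx => ?_
    rw [Set.uIoc_of_le hh] at hx
    exact hB _ (by simpa using hx.1.le) (by simpa using hx.2) (by simpa using hr)
  have h2 := key (-R) (abs_neg R)
  have h3 := key R rfl
  rw [h1]
  refine (norm_sub_le _ _).trans ?_
  rw [sub_zero, abs_of_nonneg hh] at h2 h3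
  linarith

theorem le_norm_add_two_of_re_nonneg {w : ℂ} (hw : 0 ≤ w.re) : 2 ≤ ‖w + 2‖ := by
  have := le_norm_add_of_re_nonneg hw 2
  push_cast at this
  exact this

theorem abs_im_le_norm_add_two (w : ℂ) : |w.im| ≤ ‖w + 2‖ := by
  simpa using abs_im_le_norm (w + 2)

theorem integrable_norm_rpow_neg {r : ℝ} (hr : 1 < r) :
    Integrable fun y : ℝ => ‖(y : ℂ) * I + 2‖ ^ (-r) := by
  have h1 := (integrable_one_add_norm (E := ℝ) (μ := volume) (r := r) (by simpa using hr)).const_mul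
    ((1 / 2 : ℝ) ^ (-r))
  refine h1.mono' (Measurable.pow_const (by fun_prop) _).aestronglyMeasurable
    (Eventually.of_forall fun y => ?_)
  have h2 : 1 / 2 * (1 + ‖y‖) ≤ ‖(y : ℂ) * I + 2‖ := by
    have h3 := le_norm_add_two_of_re_nonneg (w := (y : ℂ) * I) (by simp)
    have h4 := abs_im_le_norm_add_two ((y : ℂ) * I)
    simp only [mul_im, ofReal_re, I_im, mul_one, ofReal_im, I_re, mul_zero, add_zero] at h4
    rw [Real.norm_eq_abs]; linarith
  rw [Real.norm_of_nonneg (by positivity), ← Real.mul_rpow (by norm_num) (by positivity)]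
  exact Real.rpow_le_rpow_of_nonpos (by positivity) h2 (by linarith)

theorem norm_ofReal_cpow {s : ℝ} (hs : 0 < s) (w : ℂ) :
    ‖(s : ℂ) ^ w‖ = s ^ w.re := norm_cpow_eq_rpow_re_of_pos hs w

/-- On the horizontal sides, of fixed length `h`, `f` is `O(R ^ (-p))` and `s ^ (-w)` is bounded.
Only the difference of the truncated integrals is controlled, so neither has to converge absolutely.
-/
theorem vertical_integral_sub_tendsto_zero {f : ℂ → ℂ} {p : ℝ} (hf : IsMellinSymbol f p)
    (hp : 0 < p) {s : ℝ} (hs : 0 < s) {h : ℝ} (hh : 0 ≤ h) :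
    Tendsto (fun R : ℝ => (∫ y in (-R)..R, f (y * I) * (s : ℂ) ^ (-((y : ℂ) * I))) -
      ∫ y in (-R)..R, f (h + y * I) * (s : ℂ) ^ (-((h : ℂ) + y * I))) atTop (𝓝 0) := by
  obtain ⟨δ, hδ, hd⟩ := hf.differentiableOn
  obtain ⟨C, hC0, hC⟩ := hf.norm_le
  have hs' : (s : ℂ) ≠ 0 := by exact_mod_cast hs.ne'
  have hF : DifferentiableOn ℂ (fun w => f w * (s : ℂ) ^ (-w)) {w | -δ < w.re} :=
    hd.mul (differentiable_id.neg.const_cpow (Or.inl hs')).differentiableOn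
  have hlim : Tendsto (fun R : ℝ => 2 * (h * (C * R ^ (-p) * Real.exp (h * |Real.log s|)))) atTop
      (𝓝 0) := by
    have := ((((tendsto_rpow_neg_atTop hp).const_mul C).mul_const
      (Real.exp (h * |Real.log s|))).const_mul h).const_mul 2
    simpa using this
  refine squeeze_zero_norm' ?_ hlim
  filter_upwards [eventually_gt_atTop 0] with R hR
  refine norm_vertical_integral_sub_le hδ hF hh fun w hw0 hwh hwR => ?_
  have h1 : R ≤ ‖w + 2‖ := by
    have := abs_im_le_norm_add_two w
    rwa [hwR, abs_of_pos hR] at this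
  rw [norm_mul, norm_ofReal_cpow hs]
  refine mul_le_mul ((hC w hw0).trans (mul_le_mul_of_nonneg_left
    (Real.rpow_le_rpow_of_nonpos hR h1 (by linarith)) hC0)) ?_ (by positivity) (by positivity)
  rw [Real.rpow_def_of_pos hs, Real.exp_le_exp, neg_re, mul_neg, ← neg_mul]
  calc -Real.log s * w.re ≤ |Real.log s| * w.re :=
        mul_le_mul_of_nonneg_right (neg_le_abs _) hw0
    _ ≤ |Real.log s| * h := mul_le_mul_of_nonneg_left hwh (abs_nonneg _)
    _ = _ := mul_comm _ _

theorem integral_vertical_line_eq_zero {F : ℂ → ℂ} {δ : ℝ} (hδ : 0 < δ)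
    (hF : DifferentiableOn ℂ F {w | -δ < w.re}) (hint : Integrable fun y : ℝ => F (y * I))
    {K T : ℝ} (hK0 : 0 ≤ K) (hK : ∀ w : ℂ, 0 ≤ w.re → T ≤ ‖w‖ → ‖F w‖ ≤ K * ‖w‖ ^ (-2 : ℝ)) :
    ∫ y : ℝ, F (y * I) = 0 := by
  have h1 := intervalIntegral_tendsto_integral hint tendsto_neg_atTop_atBot tendsto_id
  -- Closing the contour by the rectangle of width `R` and height `2 R`, the two horizontal sides
  -- contribute `2 K / R` and the right side another `2 K / R`.
  have hlim : Tendsto (fun R : ℝ => 4 * K * R ^ (-1 : ℝ)) atTop (𝓝 0) := by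
    simpa using (tendsto_rpow_neg_atTop one_pos).const_mul (4 * K)
  refine tendsto_nhds_unique h1 (squeeze_zero_norm' ?_ hlim)
  filter_upwards [eventually_gt_atTop 0, eventually_ge_atTop T] with R hR hT
  have hbound : ∀ w : ℂ, 0 ≤ w.re → R ≤ ‖w‖ → ‖F w‖ ≤ K * R ^ (-2 : ℝ) := fun w hw hwR =>
    (hK w hw (hT.trans hwR)).trans (mul_le_mul_of_nonneg_left
      (Real.rpow_le_rpow_of_nonpos hR hwR (by norm_num)) hK0)
  have h2 := norm_vertical_integral_sub_le hδ hF hR.le (R := R) (B := K * R ^ (-2 : ℝ))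
    fun w hw0 _ hwR => hbound w hw0 (by
      have := abs_im_le_norm w
      rwa [hwR, abs_of_pos hR] at this)
  have h3 : ‖∫ y in (-R)..R, F (R + y * I)‖ ≤ (K * R ^ (-2 : ℝ)) * |R - -R| := by
    refine intervalIntegral.norm_integral_le_of_norm_le_const fun y _ =>
      hbound _ (by simpa using hR.le) ?_
    have := (le_abs_self _).trans (abs_re_le_norm ((R : ℂ) + y * I))
    simpa using this
  rw [sub_neg_eq_add, abs_of_pos (by linarith)] at h3
  have h4 : R ^ (-1 : ℝ) = R * R ^ (-2 : ℝ) := by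
    nth_rewrite 2 [← Real.rpow_one R]
    rw [← Real.rpow_add hR]; norm_num
  have h5 := norm_le_norm_sub_add (∫ y in (-R)..R, F (y * I)) (∫ y in (-R)..R, F (R + y * I))
  rw [h4]
  simp only [id]
  nlinarith

end ContourShift

/-! ### The absolutely convergent inverse Mellin transform of `f w - f (w + 1)`. -/

section DifferenceTransform

open Complex

/-- The inverse Mellin transform of `f w - f (w + 1)`, over the imaginary axis. -/
noncomputable def differenceTransform (f : ℂ → ℂ) (s : ℝ) : ℂ :=
  1 / (2 * (Real.pi : ℂ)) *
    ∫ y : ℝ, (f (y * I) - f (y * I + 1)) * (s : ℂ) ^ (-((y : ℂ) * I))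

variable {f : ℂ → ℂ} {p : ℝ}

theorem norm_ofReal_cpow_mul_I {s : ℝ} (hs : 0 < s) (y : ℝ) :
    ‖(s : ℂ) ^ (-((y : ℂ) * I))‖ = 1 := by
  rw [norm_ofReal_cpow hs]; simp

theorem measurable_ofReal_cpow_mul_I :
    Measurable fun x : ℝ × ℝ => (x.1 : ℂ) ^ (-((x.2 : ℂ) * I)) :=
  (by fun_prop : Measurable fun x : ℝ × ℝ => (x.1 : ℂ)).pow (by fun_prop)

namespace IsMellinSymbol

theorem continuous_vertical (hf : IsMellinSymbol f p) {c : ℝ} (hc : 0 ≤ c) :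
    Continuous fun y : ℝ => f (c + y * I) := by
  obtain ⟨δ, hδ, hd⟩ := hf.differentiableOn
  refine hd.continuousOn.comp_continuous (by fun_prop) fun y => ?_
  simp only [Set.mem_ofPred_eq, add_re, ofReal_re, mul_re, I_re, ofReal_im, I_im, mul_zero]
  linarith

theorem continuous_axis (hf : IsMellinSymbol f p) : Continuous fun y : ℝ => f (y * I) := by
  simpa using hf.continuous_vertical le_rfl

theorem continuous_diff (hf : IsMellinSymbol f p) :
    Continuous fun y : ℝ => f (y * I) - f (y * I + 1) := by
  refine hf.continuous_axis.sub ?_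
  simpa [add_comm] using hf.continuous_vertical zero_le_one

theorem integrable_diff (hf : IsMellinSymbol f p) (hp : 0 < p) :
    Integrable fun y : ℝ => f (y * I) - f (y * I + 1) := by
  obtain ⟨C, -, hC⟩ := hf.norm_sub_le
  exact ((integrable_norm_rpow_neg (r := p + 1) (by linarith)).const_mul C).mono'
    hf.continuous_diff.aestronglyMeasurable (Eventually.of_forall fun y => hC _ (by simp))

theorem integrable_diff_mul_cpow (hf : IsMellinSymbol f p) (hp : 0 < p) {s : ℝ} (hs : 0 < s) :
    Integrable fun y : ℝ => (f (y * I) - f (y * I + 1)) * (s : ℂ) ^ (-((y : ℂ) * I)) :=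
  (hf.integrable_diff hp).mul_bdd (c := 1)
    (measurable_ofReal_cpow_mul_I.comp (by fun_prop :
      Measurable fun y : ℝ => (s, y))).aestronglyMeasurable
    (Eventually.of_forall fun y => (norm_ofReal_cpow_mul_I hs y).le)

theorem continuous_cpow_mul_I {s : ℝ} (hs : 0 < s) (c : ℝ) :
    Continuous fun y : ℝ => (s : ℂ) ^ (-((c : ℂ) + y * I)) := by
  have hs' : (s : ℂ) ≠ 0 := by exact_mod_cast hs.ne'
  exact Continuous.const_cpow (by fun_prop) (Or.inl hs')

/-- To multiply by `s`, shift the contour to `Re w = 1`, where `s * s ^ (-(1 + i y)) = s ^ (-i y)`: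
the factor `s` thus replaces `f (i y)` by `f (i y + 1)`. The integrable difference then yields
convergence of the truncated integrals for every `p > 0`. -/
theorem one_sub_mul_tendsto (hf : IsMellinSymbol f p) (hp : 0 < p) {s : ℝ} (hs : 0 < s) :
    Tendsto (fun R : ℝ => (1 - (s : ℂ)) * (1 / (2 * (Real.pi : ℂ)) *
      ∫ y in (-R)..R, f (y * I) * (s : ℂ) ^ (-((y : ℂ) * I)))) atTop
      (𝓝 (differenceTransform f s)) := by
  have hs' : (s : ℂ) ≠ 0 := by exact_mod_cast hs.ne'
  have h1 := intervalIntegral_tendsto_integral (hf.integrable_diff_mul_cpow hp hs)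
    tendsto_neg_atTop_atBot tendsto_id
  have h2 := (vertical_integral_sub_tendsto_zero hf hp hs zero_le_one).const_mul (s : ℂ)
  have h3 := (h1.sub h2).const_mul (1 / (2 * (Real.pi : ℂ)))
  rw [mul_zero, sub_zero] at h3
  refine h3.congr fun R => ?_
  have c1 : IntervalIntegrable (fun y : ℝ => f (y * I) * (s : ℂ) ^ (-((y : ℂ) * I))) volume (-R) R := by
    have := (hf.continuous_axis.mul (continuous_cpow_mul_I hs 0))
    simp only [ofReal_zero, zero_add] at this
    exact this.intervalIntegrable _ _
  have c2 : IntervalIntegrable (fun y : ℝ => (s : ℂ) * (f ((1 : ℝ) + y * I) *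
      (s : ℂ) ^ (-(((1 : ℝ) : ℂ) + y * I)))) volume (-R) R :=
    (((hf.continuous_vertical zero_le_one).mul (continuous_cpow_mul_I hs 1)).const_mul
      _).intervalIntegrable _ _
  have e : ∫ y in (-R)..R, (f (y * I) - f (y * I + 1)) * (s : ℂ) ^ (-((y : ℂ) * I)) =
      (∫ y in (-R)..R, f (y * I) * (s : ℂ) ^ (-((y : ℂ) * I))) -
      (s : ℂ) * ∫ y in (-R)..R, f ((1 : ℝ) + y * I) *
        (s : ℂ) ^ (-(((1 : ℝ) : ℂ) + y * I)) := by
    rw [← intervalIntegral.integral_const_mul, ← intervalIntegral.integral_sub c1 c2]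
    refine intervalIntegral.integral_congr fun y _ => ?_
    have : (s : ℂ) ^ (-((y : ℂ) * I)) = s * (s : ℂ) ^ (-(((1 : ℝ) : ℂ) + y * I)) := by
      nth_rewrite 2 [← cpow_one (s : ℂ)]
      rw [← cpow_add _ _ hs']; congr 1; push_cast; ring
    rw [sub_mul]
    nth_rewrite 2 [this]
    push_cast
    rw [add_comm ((y : ℂ) * I) 1]; ring
  simp only [id]
  rw [e]; ring

/-- At `s = 1` the factor `1 - s` kills the truncated integrals before the limit. -/
theorem differenceTransform_one (hf : IsMellinSymbol f p) (hp : 0 < p) :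
    differenceTransform f 1 = 0 := by
  refine tendsto_nhds_unique (hf.one_sub_mul_tendsto hp one_pos) ?_
  simp

theorem tendsto_div_one_sub (hf : IsMellinSymbol f p) (hp : 0 < p) {s : ℝ} (hs : 0 < s)
    (hs1 : s < 1) :
    Tendsto (fun R : ℝ => 1 / (2 * (Real.pi : ℂ)) *
      ∫ y in (-R)..R, f (y * I) * (s : ℂ) ^ (-((y : ℂ) * I))) atTop
      (𝓝 (differenceTransform f s / (1 - s))) := by
  have h : 1 - (s : ℂ) ≠ 0 := by
    rw [sub_ne_zero]; exact_mod_cast hs1.ne'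
  refine ((hf.one_sub_mul_tendsto hp hs).div_const (1 - (s : ℂ))).congr fun R => ?_
  exact mul_div_cancel_left₀ _ h

end IsMellinSymbol

theorem norm_cpow_mul_I_sub_one_le {s ε : ℝ} (hs : 0 < s) (hε : 0 < ε) (hε1 : ε ≤ 1) (y : ℝ) :
    ‖(s : ℂ) ^ (-((y : ℂ) * I)) - 1‖ ≤ 2 * |y * Real.log s| ^ ε := by
  rcases le_total |y * Real.log s| 1 with h | h
  · have e : (s : ℂ) ^ (-((y : ℂ) * I)) = exp (I * ((-(y * Real.log s) : ℝ) : ℂ)) := by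
      rw [cpow_def_of_ne_zero (by exact_mod_cast hs.ne'), ← ofReal_log hs.le]
      push_cast; ring_nf
    rw [e]
    refine (Real.norm_exp_I_mul_ofReal_sub_one_le).trans ?_
    rw [norm_neg, Real.norm_eq_abs]
    have : |y * Real.log s| ^ (1 : ℝ) ≤ |y * Real.log s| ^ ε :=
      Real.rpow_le_rpow_of_exponent_ge' (abs_nonneg _) h hε.le hε1
    rw [Real.rpow_one] at this
    linarith [abs_nonneg (y * Real.log s)]
  · have h1 := norm_sub_le ((s : ℂ) ^ (-((y : ℂ) * I))) 1
    rw [norm_ofReal_cpow_mul_I hs, norm_one] at h1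
    linarith [Real.one_le_rpow h hε.le]

/-- Subtracting the vanishing value at `s = 1` replaces `s ^ (-i y)` by `s ^ (-i y) - 1`, of modulus
at most `2 |y log s| ^ ε`. The condition `ε < p` keeps the integral in `y` finite. The gain at `s =
1` is what makes division by `1 - s` harmless. -/
theorem IsMellinSymbol.exists_norm_differenceTransform_le (hf : IsMellinSymbol f p) (hp : 0 < p)
    {ε : ℝ} (hε : 0 < ε) (hε1 : ε ≤ 1) (hεp : ε < p) :
    ∃ K : ℝ, 0 ≤ K ∧ ∀ s : ℝ, 0 < s → ‖differenceTransform f s‖ ≤ K * |Real.log s| ^ ε := by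
  obtain ⟨C, hC0, hC⟩ := hf.norm_sub_le
  set J := ∫ y : ℝ, ‖(y : ℂ) * I + 2‖ ^ (-(p + 1 - ε))
  have hJ0 : 0 ≤ J := integral_nonneg fun y => by positivity
  refine ⟨1 / (2 * Real.pi) * (2 * C * J), by positivity, fun s hs => ?_⟩
  have h1 : differenceTransform f s = 1 / (2 * (Real.pi : ℂ)) *
      ∫ y : ℝ, (f (y * I) - f (y * I + 1)) * ((s : ℂ) ^ (-((y : ℂ) * I)) - 1) := by
    have h0 := hf.differenceTransform_one hp
    rw [← sub_zero (differenceTransform f s), ← h0, differenceTransform, differenceTransform,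
      ← mul_sub, ← integral_sub (hf.integrable_diff_mul_cpow hp hs)
        (hf.integrable_diff_mul_cpow hp one_pos)]
    simp only [ofReal_one, one_cpow]
    congr 2; funext y; ring
  have hint : Integrable fun y : ℝ =>
      2 * C * |Real.log s| ^ ε * ‖(y : ℂ) * I + 2‖ ^ (-(p + 1 - ε)) :=
    (integrable_norm_rpow_neg (by linarith)).const_mul _
  have h2 : ‖∫ y : ℝ, (f (y * I) - f (y * I + 1)) * ((s : ℂ) ^ (-((y : ℂ) * I)) - 1)‖ ≤
      2 * C * |Real.log s| ^ ε * J := by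
    rw [← integral_const_mul]
    refine norm_integral_le_of_norm_le hint (Eventually.of_forall fun y => ?_)
    have h3 := le_norm_add_two_of_re_nonneg (w := (y : ℂ) * I) (by simp)
    have h4 : |y| ≤ ‖(y : ℂ) * I + 2‖ := by simpa using abs_im_le_norm_add_two ((y : ℂ) * I)
    have h5 : |y * Real.log s| ^ ε ≤ ‖(y : ℂ) * I + 2‖ ^ ε * |Real.log s| ^ ε := by
      rw [abs_mul, Real.mul_rpow (abs_nonneg _) (abs_nonneg _)]
      exact mul_le_mul_of_nonneg_right (Real.rpow_le_rpow (abs_nonneg _) h4 hε.le) (by positivity)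
    rw [norm_mul, neg_sub, sub_eq_add_neg ε, Real.rpow_add (by linarith)]
    calc _ ≤ (C * ‖(y : ℂ) * I + 2‖ ^ (-(p + 1))) *
          (2 * (‖(y : ℂ) * I + 2‖ ^ ε * |Real.log s| ^ ε)) :=
          mul_le_mul (hC _ (by simp)) ((norm_cpow_mul_I_sub_one_le hs hε hε1 y).trans
            (mul_le_mul_of_nonneg_left h5 zero_le_two)) (norm_nonneg _) (by positivity)
      _ = _ := by ring
  rw [h1, norm_mul, norm_div, norm_mul, norm_one, norm_ofNat, norm_real,
    Real.norm_of_nonneg Real.pi_pos.le, mul_assoc]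
  refine mul_le_mul_of_nonneg_left (h2.trans_eq (by ring)) (by positivity)

end DifferenceTransform

/-! ### Cauchy's formula in the right half-plane. -/

section CauchyHalfPlane

open Complex

theorem norm_le_norm_add_of_re_nonneg {w : ℂ} (hw : 0 ≤ w.re) {x : ℝ} (hx : 0 ≤ x) :
    ‖w‖ ≤ ‖w + x‖ := by
  rw [← sq_le_sq₀ (norm_nonneg _) (norm_nonneg _), ← normSq_eq_norm_sq, ← normSq_eq_norm_sq,
    normSq_apply, normSq_apply]
  simp only [add_re, ofReal_re, add_im, ofReal_im, add_zero]
  nlinarith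

theorem integrable_two_mul_div_sq_add_sq {u : ℝ} (hu : 0 < u) :
    Integrable (fun y : ℝ => 2 * u / (y ^ 2 + u ^ 2)) ∧
      ∫ y : ℝ, 2 * u / (y ^ 2 + u ^ 2) = 2 * Real.pi := by
  have e : (fun y : ℝ => 2 * u / (y ^ 2 + u ^ 2)) = fun y => 2 / u * (1 + (y / u) ^ 2)⁻¹ := by
    funext y
    have : 0 < y ^ 2 + u ^ 2 := by positivity
    have : 0 < 1 + (y / u) ^ 2 := by positivity
    field_simp; ring
  rw [e]
  refine ⟨(integrable_inv_one_add_sq.comp_div hu.ne').const_mul _, ?_⟩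
  rw [integral_const_mul, Measure.integral_comp_div (fun x : ℝ => (1 + x ^ 2)⁻¹),
    integral_univ_inv_one_add_sq, smul_eq_mul, abs_of_pos hu]
  field_simp

theorem vertical_sub_ne_zero {u : ℝ} (hu : 0 < u) (y : ℝ) : (u : ℂ) - y * I ≠ 0 := fun h => by
  have := congrArg re h
  simp at this; linarith

theorem continuous_inv_vertical_sub {u : ℝ} (hu : 0 < u) :
    Continuous fun y : ℝ => ((u : ℂ) - y * I)⁻¹ :=
  Continuous.inv₀ (by fun_prop) (vertical_sub_ne_zero hu)

theorem norm_inv_vertical_sub_le {u : ℝ} (hu : 0 < u) (y : ℝ) :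
    ‖((u : ℂ) - y * I)⁻¹‖ ≤ u⁻¹ := by
  rw [norm_inv]
  refine inv_anti₀ hu ((le_abs_self u).trans ?_)
  simpa using abs_re_le_norm ((u : ℂ) - y * I)

/-- Subtracting `2 u d(u) / (w + u)`, whose pole `-u` lies to the left, makes `d` vanish at `u`. The
quotient by `w - u` is then holomorphic and `O(|w|⁻²)`, so its integral over the axis is zero. On
the axis the correction becomes the Poisson kernel `2 u / (y ^ 2 + u ^ 2)`, of total mass `2 π`. -/
theorem integral_div_vertical_sub {d : ℂ → ℂ} {δ C : ℝ} (hδ : 0 < δ)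
    (hd : DifferentiableOn ℂ d {w | -δ < w.re})
    (hC : ∀ w : ℂ, 0 ≤ w.re → ‖d w‖ ≤ C * ‖w + 2‖⁻¹) (hint : Integrable fun y : ℝ => d (y * I))
    {u : ℝ} (hu : 0 < u) :
    ∫ y : ℝ, d (y * I) / (u - y * I) = 2 * Real.pi * d u := by
  have huC : (u : ℂ) ≠ 0 := by exact_mod_cast hu.ne'
  set m : ℂ → ℂ := fun w => d w - 2 * u * d u / (w + u) with hm
  have hmu : m u = 0 := by
    simp only [hm]; rw [← two_mul, mul_div_cancel_left₀ _ (by simpa using huC), sub_self]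
  have hη : 0 < min δ u := lt_min hδ hu
  set U : Set ℂ := {w | -min δ u < w.re} with hU
  have hUo : IsOpen U := isOpen_lt continuous_const continuous_re
  have hUu : U ∈ 𝓝 (u : ℂ) := hUo.mem_nhds (by simp only [hU, Set.mem_ofPred_eq, ofReal_re]; linarith)
  have hmd : DifferentiableOn ℂ m U := by
    refine (hd.mono fun w hw => ?_).sub ?_
    · have hw : -min δ u < w.re := hw
      exact lt_of_le_of_lt (neg_le_neg (min_le_left _ _)) hw
    · refine (differentiableOn_const _).div (differentiableOn_id.add_const _) fun w hw h => ?_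
      have h1 := congrArg re h
      have h2 : -min δ u < w.re := hw
      have h3 := min_le_right δ u
      simp at h1; linarith
  set F := dslope m u with hF
  have hFd : DifferentiableOn ℂ F U := (differentiableOn_dslope hUu).2 hmd
  have hFne : ∀ w : ℂ, w ≠ u → F w = (w - u)⁻¹ * m w := fun w hw => by
    rw [hF, dslope_of_ne _ hw, slope_def_module, hmu, sub_zero, smul_eq_mul]
  have hline : ∀ y : ℝ, F (y * I) =
      -(d (y * I) * ((u : ℂ) - y * I)⁻¹) + d u * ((2 * u / (y ^ 2 + u ^ 2) : ℝ) : ℂ) := fun y => by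
    have h1 := vertical_sub_ne_zero hu y
    have h2 : (y : ℂ) * I - u ≠ 0 := by rw [← neg_sub]; exact neg_ne_zero.2 h1
    have h3 : (y : ℂ) * I + u ≠ 0 := fun h => by
      have := congrArg re h
      simp at this; linarith
    have h4 : (y : ℂ) ^ 2 + (u : ℂ) ^ 2 = ((u : ℂ) - y * I) * (y * I + u) := by
      ring_nf; rw [I_sq]; ring
    rw [hFne _ (sub_ne_zero.1 h2)]
    simp only [hm]
    push_cast
    rw [h4, ← neg_sub (u : ℂ) (y * I)]
    field_simp
    ring
  have hint1 : Integrable fun y : ℝ => d (y * I) * ((u : ℂ) - y * I)⁻¹ :=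
    hint.mul_bdd (continuous_inv_vertical_sub hu).aestronglyMeasurable
      (Eventually.of_forall fun y => norm_inv_vertical_sub_le hu y)
  have hint2 : Integrable fun y : ℝ => d u * ((2 * u / (y ^ 2 + u ^ 2) : ℝ) : ℂ) :=
    ((integrable_two_mul_div_sq_add_sq hu).1.ofReal).const_mul _
  have hzero : ∫ y : ℝ, F (y * I) = 0 := by
    have hC0 : 0 ≤ C := by
      have := (norm_nonneg _).trans (hC 0 le_rfl)
      rw [zero_add] at this
      exact nonneg_of_mul_nonneg_left this (by simp)
    -- For `|w| ≥ 2 u` one has `|w - u| ≥ |w| / 2`, which accounts for the factor `2` in `K`.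
    refine integral_vertical_line_eq_zero hη hFd ?_ (T := 2 * u)
      (K := 2 * (C + 2 * u * ‖d u‖)) (by positivity) fun w hw hT => ?_
    · simp only [hline]; exact hint1.neg.add hint2
    · have hw0 : 0 < ‖w‖ := by linarith
      have h1 : ‖w‖ / 2 ≤ ‖w - u‖ := by
        have := norm_sub_norm_le w u
        rw [norm_real, Real.norm_of_nonneg hu.le] at this
        linarith
      have hne : w ≠ u := fun h => by
        rw [h, norm_real, Real.norm_of_nonneg hu.le] at hT; linarith
      have h2 : ‖m w‖ ≤ (C + 2 * u * ‖d u‖) * ‖w‖⁻¹ := by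
        refine (norm_sub_le _ _).trans ?_
        rw [add_mul]
        refine add_le_add ((hC w hw).trans (mul_le_mul_of_nonneg_left (inv_anti₀ hw0 ?_) hC0)) ?_
        · exact_mod_cast norm_le_norm_add_of_re_nonneg hw zero_le_two
        rw [norm_div, norm_mul, norm_mul, norm_real, Real.norm_of_nonneg hu.le, norm_ofNat,
          div_eq_mul_inv]
        exact mul_le_mul_of_nonneg_left
          (inv_anti₀ hw0 (norm_le_norm_add_of_re_nonneg hw hu.le)) (by positivity)
      rw [hFne w hne, norm_mul, norm_inv]
      calc _ ≤ (‖w‖ / 2)⁻¹ * ((C + 2 * u * ‖d u‖) * ‖w‖⁻¹) :=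
            mul_le_mul (inv_anti₀ (by positivity) h1) h2 (norm_nonneg _) (by positivity)
        _ = _ := by
          rw [Real.rpow_neg hw0.le, Real.rpow_two]; field_simp
  simp only [hline] at hzero
  have hsum := integral_add hint1.neg hint2
  simp only [Pi.neg_apply] at hsum
  rw [hsum, integral_neg, integral_const_mul, integral_complex_ofReal,
    (integrable_two_mul_div_sq_add_sq hu).2] at hzero
  simp only [div_eq_mul_inv]
  push_cast at hzero
  linear_combination -hzero

end CauchyHalfPlane

/-! ### Mellin transform of the difference transform. -/

section MellinTransform

open Complex

variable {f : ℂ → ℂ} {p : ℝ}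

theorem norm_ofReal_cpow_sub_one {s : ℝ} (hs : 0 < s) (u : ℝ) :
    ‖(s : ℂ) ^ ((u : ℂ) - 1)‖ = s ^ (u - 1) := by
  rw [norm_ofReal_cpow hs]; simp

theorem measurable_ofReal_cpow (w : ℂ) : Measurable fun s : ℝ => (s : ℂ) ^ w :=
  measurable_ofReal.pow_const w

theorem integrableOn_rpow_sub_one {u : ℝ} (hu : 0 < u) :
    IntegrableOn (fun s : ℝ => s ^ (u - 1)) (Set.Ioo 0 1) := by
  have := (intervalIntegral.intervalIntegrable_rpow' (a := 0) (b := 1) (r := u - 1)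
    (by linarith))
  rw [intervalIntegrable_iff_integrableOn_Ioo_of_le zero_le_one] at this
  exact this

theorem integrableOn_cpow_sub_one {u : ℝ} (hu : 0 < u) :
    IntegrableOn (fun s : ℝ => (s : ℂ) ^ ((u : ℂ) - 1)) (Set.Ioo 0 1) := by
  refine (integrableOn_rpow_sub_one hu).mono' (measurable_ofReal_cpow _).aestronglyMeasurable ?_
  filter_upwards [ae_restrict_mem measurableSet_Ioo] with s hs
  exact (norm_ofReal_cpow_sub_one hs.1 u).le

/-- By Fubini the integral in `s` can be taken inside; it gives `1 / (u - i y)`, and Cauchy's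
formula evaluates the rest. -/
theorem IsMellinSymbol.integral_cpow_mul_differenceTransform (hf : IsMellinSymbol f p)
    (hp : 0 < p) {u : ℝ} (hu : 0 < u) :
    ∫ s in Set.Ioo (0 : ℝ) 1, (s : ℂ) ^ ((u : ℂ) - 1) * differenceTransform f s =
      f u - f (u + 1) := by
  set d : ℂ → ℂ := fun w => f w - f (w + 1) with hd
  have hdi : Integrable fun y : ℝ => d (y * I) := hf.integrable_diff hp
  have hprod : Integrable (Function.uncurry fun (s : ℝ) (y : ℝ) =>
      ((s : ℂ) ^ ((u : ℂ) - 1) * d (y * I)) * (s : ℂ) ^ (-((y : ℂ) * I)))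
      ((volume.restrict (Set.Ioo (0 : ℝ) 1)).prod volume) := by
    refine ((integrableOn_cpow_sub_one hu).mul_prod hdi).mul_bdd (c := 1)
      measurable_ofReal_cpow_mul_I.aestronglyMeasurable ?_
    have : ∀ᵐ x ∂((volume.restrict (Set.Ioo (0 : ℝ) 1)).prod (volume : Measure ℝ)),
        x.1 ∈ Set.Ioo (0 : ℝ) 1 :=
      Measure.quasiMeasurePreserving_fst.ae (ae_restrict_mem measurableSet_Ioo)
    filter_upwards [this] with x hx
    exact (norm_ofReal_cpow_mul_I hx.1 x.2).le
  have hinner : ∀ y : ℝ, ∫ s in Set.Ioo (0 : ℝ) 1,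
      ((s : ℂ) ^ ((u : ℂ) - 1) * d (y * I)) * (s : ℂ) ^ (-((y : ℂ) * I)) =
      d (y * I) / (u - y * I) := fun y => by
    have h1 : ∫ s in Set.Ioo (0 : ℝ) 1, (s : ℂ) ^ ((u : ℂ) - y * I - 1) = 1 / (u - y * I) := by
      rw [← integral_Ioc_eq_integral_Ioo, ← intervalIntegral.integral_of_le zero_le_one,
        integral_cpow (Or.inl (by simp; linarith))]
      simp [zero_cpow (vertical_sub_ne_zero hu y)]
    rw [div_eq_mul_one_div, ← h1, ← integral_const_mul]
    refine setIntegral_congr_fun measurableSet_Ioo fun s hs => ?_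
    have hs0 : (s : ℂ) ≠ 0 := by exact_mod_cast hs.1.ne'
    have : (s : ℂ) ^ ((u : ℂ) - y * I - 1) =
        (s : ℂ) ^ ((u : ℂ) - 1) * (s : ℂ) ^ (-((y : ℂ) * I)) := by
      rw [← cpow_add _ _ hs0]; ring_nf
    simp only [this]; ring
  have hC : ∃ C, ∀ w : ℂ, 0 ≤ w.re → ‖d w‖ ≤ C * ‖w + 2‖⁻¹ := by
    obtain ⟨C, hC0, hC⟩ := hf.norm_sub_le
    refine ⟨C, fun w hw => ?_⟩
    have h2 := le_norm_add_two_of_re_nonneg hw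
    refine (hC w hw).trans (mul_le_mul_of_nonneg_left ?_ hC0)
    rw [← Real.rpow_neg_one]
    exact Real.rpow_le_rpow_of_exponent_le (by linarith) (by linarith)
  obtain ⟨C, hC⟩ := hC
  obtain ⟨δ, hδ, hfd⟩ := hf.differentiableOn
  have hdd : DifferentiableOn ℂ d {w | -δ < w.re} := by
    refine hfd.sub (hfd.comp (differentiableOn_id.add_const 1) fun w hw => ?_)
    have hw : -δ < w.re := hw
    simp only [Set.mem_ofPred_eq, add_re, one_re]; linarith
  calc _ = ∫ s in Set.Ioo (0 : ℝ) 1, 1 / (2 * (Real.pi : ℂ)) * ∫ y : ℝ,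
        ((s : ℂ) ^ ((u : ℂ) - 1) * d (y * I)) * (s : ℂ) ^ (-((y : ℂ) * I)) := by
        congr 1; funext s
        rw [differenceTransform, mul_left_comm, ← integral_const_mul]
        simp only [hd, mul_assoc]
    _ = 1 / (2 * (Real.pi : ℂ)) * ∫ y : ℝ, d (y * I) / (u - y * I) := by
        rw [integral_const_mul, integral_integral_swap hprod]
        simp only [hinner]
    _ = _ := by
        rw [integral_div_vertical_sub hδ hdd hC hdi hu]
        have : (Real.pi : ℂ) ≠ 0 := by exact_mod_cast Real.pi_ne_zero
        field_simp
        rfl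

end MellinTransform

/-! ### Mellin inversion after division by `1 - s`. -/

section MellinInversion

open Complex

variable {f : ℂ → ℂ} {p : ℝ}

theorem stronglyMeasurable_differenceTransform (hf : IsMellinSymbol f p) :
    StronglyMeasurable (differenceTransform f) := by
  refine StronglyMeasurable.const_mul ?_ _
  refine StronglyMeasurable.integral_prod_right
    (f := fun (s : ℝ) (y : ℝ) => (f (y * I) - f (y * I + 1)) * (s : ℂ) ^ (-((y : ℂ) * I))) ?_
  exact ((hf.continuous_diff.measurable.comp measurable_snd).mul
    measurable_ofReal_cpow_mul_I).stronglyMeasurable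

theorem integrableOn_rpow_mul_one_sub_rpow {u v : ℝ} (hu : 0 < u) (hv : 0 < v) :
    IntegrableOn (fun s : ℝ => s ^ (u - 1) * (1 - s) ^ (v - 1)) (Set.Ioo 0 1) := by
  have h := betaIntegral_convergent (u := u) (v := v) (by simpa) (by simpa)
  rw [intervalIntegrable_iff_integrableOn_Ioo_of_le zero_le_one] at h
  refine IntegrableOn.congr_fun (f := fun s : ℝ => ‖(s : ℂ) ^ ((u : ℂ) - 1) * (1 - (s : ℂ)) ^ ((v : ℂ) - 1)‖)
    h.norm (fun s hs => ?_) measurableSet_Ioo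
  have e : (1 : ℂ) - s = ((1 - s : ℝ) : ℂ) := by push_cast; ring
  simp only [norm_mul]
  rw [e, norm_ofReal_cpow_sub_one hs.1, norm_ofReal_cpow_sub_one (by linarith [hs.2])]

namespace IsMellinSymbol

/-- With `|log s| ≤ (1 - s) / s`, the Hölder bound gives the Beta majorant `s ^ (u - ε - 1) (1 - s)
^ (ε - 1)`; hence `ε` must lie below `u` as well as below `p`. -/
theorem integrableOn_cpow_mul_div (hf : IsMellinSymbol f p) (hp : 0 < p) {u : ℝ} (hu : 0 < u) :
    IntegrableOn (fun s : ℝ => (s : ℂ) ^ ((u : ℂ) - 1) * (differenceTransform f s / (1 - s)))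
      (Set.Ioo 0 1) := by
  obtain ⟨ε, hε, hε1, hεp, hεu⟩ : ∃ ε : ℝ, 0 < ε ∧ ε ≤ 1 ∧ ε < p ∧ ε < u := by
    refine ⟨min 1 (min (p / 2) (u / 2)), by positivity, min_le_left _ _, ?_, ?_⟩
    · have := (min_le_right 1 (min (p / 2) (u / 2))).trans (min_le_left _ _); linarith
    · have := (min_le_right 1 (min (p / 2) (u / 2))).trans (min_le_right _ _); linarith
  obtain ⟨K, hK0, hK⟩ := hf.exists_norm_differenceTransform_le hp hε hε1 hεp
  refine ((integrableOn_rpow_mul_one_sub_rpow (sub_pos.2 hεu) hε).const_mul K).mono' ?_ ?_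
  · refine ((measurable_ofReal_cpow _).mul
      ((stronglyMeasurable_differenceTransform hf).measurable.div ?_)).aestronglyMeasurable
    fun_prop
  filter_upwards [ae_restrict_mem measurableSet_Ioo] with s hs
  have hs0 := hs.1
  have hs1 : 0 < 1 - s := by linarith [hs.2]
  have hlog : |Real.log s| ≤ (1 - s) / s := by
    rw [abs_of_nonpos (Real.log_nonpos hs0.le hs.2.le), ← Real.log_inv]
    refine (Real.log_le_sub_one_of_pos (inv_pos.2 hs0)).trans_eq ?_
    field_simp
  have h1 : ‖differenceTransform f s‖ ≤ K * ((1 - s) ^ ε * s ^ (-ε)) := by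
    refine (hK s hs0).trans (mul_le_mul_of_nonneg_left ?_ hK0)
    rw [Real.rpow_neg hs0.le, ← div_eq_mul_inv, ← Real.div_rpow hs1.le hs0.le]
    exact Real.rpow_le_rpow (abs_nonneg _) hlog hε.le
  have e : ‖(1 : ℂ) - s‖ = 1 - s := by
    rw [show (1 : ℂ) - s = ((1 - s : ℝ) : ℂ) by push_cast; ring, norm_real,
      Real.norm_of_nonneg hs1.le]
  rw [norm_mul, norm_div, e, norm_ofReal_cpow_sub_one hs0]
  have h2 : s ^ (u - ε - 1) = s ^ (u - 1) * s ^ (-ε) := by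
    rw [← Real.rpow_add hs0]; ring_nf
  have h3 : (1 - s) ^ (ε - 1) = (1 - s) ^ ε / (1 - s) := Real.rpow_sub_one hs1.ne' ε
  rw [h2, h3]
  calc _ ≤ s ^ (u - 1) * (K * ((1 - s) ^ ε * s ^ (-ε)) / (1 - s)) := by gcongr
    _ = _ := by ring

theorem natCast_add_tendsto_zero (hf : IsMellinSymbol f p) (hp : 0 < p) {u : ℝ} (hu : 0 < u) :
    Tendsto (fun n : ℕ => f ((u + n : ℝ) : ℂ)) atTop (𝓝 0) := by
  obtain ⟨C, hC0, hC⟩ := hf.norm_le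
  have hlim : Tendsto (fun n : ℕ => C * (n : ℝ) ^ (-p)) atTop (𝓝 0) := by
    simpa using ((tendsto_rpow_neg_atTop hp).comp tendsto_natCast_atTop_atTop).const_mul C
  refine squeeze_zero_norm' ?_ hlim
  filter_upwards [eventually_gt_atTop 0] with n hn
  have hn' : (0 : ℝ) < n := by exact_mod_cast hn
  refine (hC _ (by rw [ofReal_re]; positivity)).trans (mul_le_mul_of_nonneg_left
    (Real.rpow_le_rpow_of_nonpos hn' ?_ (by linarith)) hC0)
  rw [← ofReal_ofNat, ← ofReal_add, norm_real, Real.norm_of_nonneg (by positivity)]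
  linarith

/-- Mellin inversion: `f` is the Mellin transform of `differenceTransform f s / (1 - s)` on
`(0, 1)`. -/
theorem integral_cpow_mul_div (hf : IsMellinSymbol f p) (hp : 0 < p) {u : ℝ} (hu : 0 < u) :
    ∫ s in Set.Ioo (0 : ℝ) 1, (s : ℂ) ^ ((u : ℂ) - 1) *
      (differenceTransform f s / (1 - s)) = f u := by
  set J : ℝ → ℂ := fun u => ∫ s in Set.Ioo (0 : ℝ) 1, (s : ℂ) ^ ((u : ℂ) - 1) *
      (differenceTransform f s / (1 - s)) with hJ
  -- In `J v - J (v + 1)` the factor `1 - s` cancels, leaving the known transform of the difference.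
  -- So `J - f` is unchanged under `v → v + 1`; both terms tend to zero along `u + n`, hence `J u =
  -- f u`.
  have hstep : ∀ v : ℝ, 0 < v → J v - f v = J (v + 1) - f ((v + 1 : ℝ) : ℂ) := fun v hv => by
    have h1 : J v - J (v + 1) = f v - f (v + 1) := by
      rw [← hf.integral_cpow_mul_differenceTransform hp hv, hJ]
      simp only []
      rw [← integral_sub (hf.integrableOn_cpow_mul_div hp hv)
        (hf.integrableOn_cpow_mul_div hp (by linarith))]
      refine setIntegral_congr_fun measurableSet_Ioo fun s hs => ?_
      have hs0 : (s : ℂ) ≠ 0 := by exact_mod_cast hs.1.ne'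
      have hs1 : (1 : ℂ) - s ≠ 0 := sub_ne_zero.2 (by exact_mod_cast hs.2.ne')
      have h2 : (s : ℂ) ^ (((v + 1 : ℝ) : ℂ) - 1) = (s : ℂ) ^ ((v : ℂ) - 1) * s := by
        nth_rewrite 3 [← cpow_one (s : ℂ)]
        rw [← cpow_add _ _ hs0]; push_cast; ring_nf
      simp only [h2]
      field_simp
    push_cast
    linear_combination h1
  have hall : ∀ n : ℕ, J u - f u = J (u + n) - f ((u + n : ℝ) : ℂ) := fun n => by
    induction n with
    | zero => simp
    | succ n ih =>
      rw [ih, hstep _ (by positivity)]; push_cast; rw [add_assoc, add_assoc]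
  have hJlim : Tendsto (fun n : ℕ => J (u + n)) atTop (𝓝 0) := by
    have hz : (0 : ℂ) = ∫ s in Set.Ioo (0 : ℝ) 1, (0 : ℂ) := by simp
    rw [hz]
    refine tendsto_integral_of_dominated_convergence
      (fun s : ℝ => ‖(s : ℂ) ^ ((u : ℂ) - 1) * (differenceTransform f s / (1 - s))‖)
      (fun n => (hf.integrableOn_cpow_mul_div hp (by positivity)).aestronglyMeasurable)
      (hf.integrableOn_cpow_mul_div hp hu).norm (fun n => ?_) ?_
    · filter_upwards [ae_restrict_mem measurableSet_Ioo] with s hs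
      rw [norm_mul, norm_mul, norm_ofReal_cpow_sub_one hs.1, norm_ofReal_cpow_sub_one hs.1]
      refine mul_le_mul_of_nonneg_right (Real.rpow_le_rpow_of_exponent_ge hs.1 hs.2.le ?_)
        (norm_nonneg _)
      have : (0 : ℝ) ≤ n := n.cast_nonneg
      linarith
    · filter_upwards [ae_restrict_mem measurableSet_Ioo] with s hs
      have hs0 : (s : ℂ) ≠ 0 := by exact_mod_cast hs.1.ne'
      have h1 : Tendsto (fun n : ℕ => (s : ℂ) ^ n * ((s : ℂ) ^ ((u : ℂ) - 1) *
          (differenceTransform f s / (1 - s)))) atTop (𝓝 0) := by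
        have := (tendsto_pow_atTop_nhds_zero_of_norm_lt_one (x := (s : ℂ)) (by
          rw [norm_real, Real.norm_of_nonneg hs.1.le]; exact hs.2)).mul_const
          ((s : ℂ) ^ ((u : ℂ) - 1) * (differenceTransform f s / (1 - s)))
        simpa using this
      refine h1.congr fun n => ?_
      rw [← mul_assoc, ← cpow_natCast, ← cpow_add _ _ hs0]
      push_cast; ring_nf
  have hlim := hJlim.sub (hf.natCast_add_tendsto_zero hp hu)
  rw [sub_zero] at hlim
  have := tendsto_nhds_unique (tendsto_const_nhds.congr hall) hlim
  exact sub_eq_zero.1 this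

end IsMellinSymbol

end MellinInversion

/-! ### The Meijer density and its Mellin transform. -/

section Density

open Complex

variable {q : ℕ} {a b : Fin q → ℂ}

theorem gammaProd_add (a b : Fin q → ℂ) (c w : ℂ) :
    gammaProd (fun i => a i + c) (fun i => b i + c) w = gammaProd a b (c + w) := by
  simp only [gammaProd, add_assoc]

theorem hypPsi_add (a b : Fin q → ℂ) (c : ℂ) :
    hypPsi (fun i => a i + c) (fun i => b i + c) = hypPsi a b := by
  simp [hypPsi]

/-- Adding `c` to all parameters brings the line `Re = c` to the imaginary axis; the extra `h`
leaves room for a later contour shift. -/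
theorem meijerGTrunc_eq (a b : Fin q → ℂ) {s : ℝ} (hs : 0 < s) (c h R : ℝ) :
    meijerGTrunc (c + h) b a (s : ℂ) R = (s : ℂ) ^ (-(c : ℂ)) * (1 / (2 * (Real.pi : ℂ)) *
      ∫ y in (-R)..R, gammaProd (fun i => a i + c) (fun i => b i + c) (h + y * I) *
        (s : ℂ) ^ (-((h : ℂ) + y * I))) := by
  have hs' : (s : ℂ) ≠ 0 := by exact_mod_cast hs.ne'
  rw [meijerGTrunc, ← intervalIntegral.integral_const_mul, ← intervalIntegral.integral_const_mul,
    ← intervalIntegral.integral_const_mul]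
  refine intervalIntegral.integral_congr fun y _ => ?_
  have e : (s : ℂ) ^ (-(((c + h : ℝ) : ℂ) + y * I)) =
      (s : ℂ) ^ (-(c : ℂ)) * (s : ℂ) ^ (-((h : ℂ) + y * I)) := by
    rw [← cpow_add _ _ hs']; push_cast; ring_nf
  simp only [e, gammaProd]
  push_cast
  simp only [add_assoc]
  have hpi : (Real.pi : ℂ) ≠ 0 := by exact_mod_cast Real.pi_ne_zero
  have hI := I_ne_zero
  field_simp

theorem isMellinSymbol_gammaProd_add {c : ℝ} (hc : ∀ i, -(a i).re < c)
    (hψ : 0 < (hypPsi a b).re) :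
    IsMellinSymbol (gammaProd (fun i => a i + c) (fun i => b i + c)) (hypPsi a b).re := by
  rw [← hypPsi_add a b c]
  refine isMellinSymbol_gammaProd (fun i => ?_) (by rwa [hypPsi_add])
  have := hc i
  simp only [add_re, ofReal_re]; linarith

theorem meijerGTrunc_tendsto {c h : ℝ} (hc : ∀ i, -(a i).re < c) (hh : 0 ≤ h)
    (hψ : 0 < (hypPsi a b).re) {s : ℝ} (hs : 0 < s) (hs1 : s < 1) :
    Tendsto (meijerGTrunc (c + h) b a (s : ℂ)) atTop (𝓝 ((s : ℂ) ^ (-(c : ℂ)) *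
      (differenceTransform (gammaProd (fun i => a i + c) (fun i => b i + c)) s / (1 - s)))) := by
  have hf := isMellinSymbol_gammaProd_add (b := b) hc hψ
  have h1 := hf.tendsto_div_one_sub hψ hs hs1
  have h2 := (vertical_integral_sub_tendsto_zero hf hψ hs hh).const_mul (1 / (2 * (Real.pi : ℂ)))
  have h3 := (h1.sub h2).const_mul ((s : ℂ) ^ (-(c : ℂ)))
  rw [mul_zero, sub_zero] at h3
  refine h3.congr fun R => ?_
  rw [meijerGTrunc_eq a b hs]
  ring

/-- A negative abscissa makes the Mellin variable `t - c₂` positive already at `t = 0`, which is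
summability of the density. The condition `c₂ ≤ c` is there because contours are shifted only to the
right. -/
theorem exists_lt_zero_lt_re (ha : ∀ i, 0 < (a i).re) {c : ℝ} (hc : ∀ i, -(a i).re < c) :
    ∃ c₂ : ℝ, c₂ < 0 ∧ c₂ ≤ c ∧ ∀ i, -(a i).re < c₂ := by
  obtain ⟨η, hη, h⟩ := exists_pos_lt_re (a := fun i => a i + (min 0 c : ℝ)) fun i => by
    have := lt_min (show -(a i).re < 0 by linarith [ha i]) (hc i)
    simp only [add_re, ofReal_re]; linarith
  refine ⟨min 0 c - η, ?_, ?_, fun i => ?_⟩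
  · linarith [min_le_left 0 c]
  · linarith [min_le_right 0 c]
  · have := h i
    simp only [add_re, ofReal_re] at this; linarith

theorem meijerGTrunc_tendsto_meijerG (hψ : 0 < (hypPsi a b).re) {c : ℝ}
    (hc : ∀ i, -(a i).re < c) {s : ℝ} (hs : 0 < s) (hs1 : s < 1) :
    Tendsto (meijerGTrunc c b a (s : ℂ)) atTop (𝓝 (meijerG c b a (s : ℂ))) := by
  have h := meijerGTrunc_tendsto hc le_rfl hψ hs hs1
  rw [add_zero] at h
  rw [meijerG, h.limUnder_eq]
  exact h

/-- The integrand of the Mellin transform of `hypDensity`, for some `c₂ < 0`. -/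
theorem exists_cpow_mul_hypDensity_eq (ha : ∀ i, 0 < (a i).re) (hψ : 0 < (hypPsi a b).re) {c : ℝ}
    (hc : ∀ i, -(a i).re < c) :
    ∃ c₂ : ℝ, c₂ < 0 ∧ (∀ i, -(a i).re < c₂) ∧ ∀ s ∈ Set.Ioo (0 : ℝ) 1, ∀ t : ℝ,
      (s : ℂ) ^ (t : ℂ) * hypDensity c a b s =
        (∏ i, Gamma (b i) / Gamma (a i)) * ((s : ℂ) ^ (((t - c₂ : ℝ) : ℂ) - 1) *
        (differenceTransform (gammaProd (fun i => a i + c₂) (fun i => b i + c₂)) s /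
          (1 - s))) := by
  obtain ⟨c₂, h0, hle, hc₂⟩ := exists_lt_zero_lt_re ha hc
  refine ⟨c₂, h0, hc₂, fun s hs t => ?_⟩
  have hs' : (s : ℂ) ≠ 0 := by exact_mod_cast hs.1.ne'
  have h := meijerGTrunc_tendsto hc₂ (sub_nonneg.2 hle) hψ hs.1 hs.2
  rw [add_sub_cancel] at h
  have e : (s : ℂ) ^ (((t - c₂ : ℝ) : ℂ) - 1) =
      (s : ℂ) ^ (t : ℂ) * (1 / (s : ℂ)) * (s : ℂ) ^ (-(c₂ : ℂ)) := by
    rw [one_div, ← cpow_neg_one, ← cpow_add _ _ hs', ← cpow_add _ _ hs']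
    push_cast; ring_nf
  rw [hypDensity, meijerG, h.limUnder_eq, e]
  ring

theorem integrableOn_cpow_mul_hypDensity (ha : ∀ i, 0 < (a i).re) (hψ : 0 < (hypPsi a b).re)
    {c : ℝ} (hc : ∀ i, -(a i).re < c) {t : ℝ} (ht : 0 ≤ t) :
    IntegrableOn (fun s : ℝ => (s : ℂ) ^ (t : ℂ) * hypDensity c a b s) (Set.Ioo 0 1) := by
  obtain ⟨c₂, h0, hc₂, h⟩ := exists_cpow_mul_hypDensity_eq ha hψ hc
  have hf := isMellinSymbol_gammaProd_add (b := b) hc₂ hψ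
  refine IntegrableOn.congr_fun ((hf.integrableOn_cpow_mul_div hψ
    (u := t - c₂) (by linarith)).const_mul (∏ i, Gamma (b i) / Gamma (a i)))
    (fun s hs => (h s hs t).symm) measurableSet_Ioo

theorem integrableOn_hypDensity (ha : ∀ i, 0 < (a i).re) (hψ : 0 < (hypPsi a b).re)
    {c : ℝ} (hc : ∀ i, -(a i).re < c) : IntegrableOn (hypDensity c a b) (Set.Icc 0 1) := by
  rw [integrableOn_Icc_iff_integrableOn_Ioo]
  simpa using integrableOn_cpow_mul_hypDensity ha hψ hc le_rfl

theorem integral_cpow_mul_hypDensity (ha : ∀ i, 0 < (a i).re) (hψ : 0 < (hypPsi a b).re)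
    {c : ℝ} (hc : ∀ i, -(a i).re < c) {t : ℝ} (ht : 0 ≤ t) :
    ∫ s in Set.Icc (0 : ℝ) 1, (s : ℂ) ^ (t : ℂ) * hypDensity c a b s =
      (∏ i, Gamma (b i) / Gamma (a i)) * gammaProd a b t := by
  obtain ⟨c₂, h0, hc₂, h⟩ := exists_cpow_mul_hypDensity_eq ha hψ hc
  have hf := isMellinSymbol_gammaProd_add (b := b) hc₂ hψ
  rw [integral_Icc_eq_integral_Ioo, setIntegral_congr_fun measurableSet_Ioo
    (fun s hs => h s hs t), integral_const_mul,
    hf.integral_cpow_mul_div hψ (by linarith), gammaProd_add]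
  push_cast
  ring_nf

end Density

/-! ### Uniqueness in the moment problem on `[0, 1]`. -/

section Moments

theorem integral_polynomial_mul_eq_zero {ρ : ℝ → ℂ} (hρ : IntegrableOn ρ (Set.Icc 0 1))
    (h : ∀ n : ℕ, ∫ s in Set.Icc (0 : ℝ) 1, (s : ℂ) ^ n * ρ s = 0) (P : Polynomial ℝ) :
    ∫ s in Set.Icc (0 : ℝ) 1, ((P.eval s : ℝ) : ℂ) * ρ s = 0 := by
  have hint : ∀ n : ℕ, IntegrableOn (fun s : ℝ => (s : ℂ) ^ n * ρ s) (Set.Icc 0 1) := fun n =>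
    hρ.continuousOn_mul (by fun_prop) isCompact_Icc
  have e : ∀ s : ℝ, ((P.eval s : ℝ) : ℂ) * ρ s =
      ∑ n ∈ Finset.range (P.natDegree + 1), (P.coeff n : ℂ) * ((s : ℂ) ^ n * ρ s) := fun s => by
    rw [Polynomial.eval_eq_sum_range]
    push_cast
    rw [Finset.sum_mul]
    exact Finset.sum_congr rfl fun n _ => by ring
  simp only [e]
  rw [integral_finsetSum _ fun n _ => (hint n).const_mul _]
  refine Finset.sum_eq_zero fun n _ => ?_
  rw [integral_const_mul, h n, mul_zero]

/-- A smooth test function is a uniform limit of polynomials on `[0, 1]`, so its integral against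
`ρ` vanishes. -/
theorem ae_eq_zero_of_moments_eq_zero {ρ : ℝ → ℂ} (hρ : IntegrableOn ρ (Set.Icc 0 1))
    (h : ∀ n : ℕ, ∫ s in Set.Icc (0 : ℝ) 1, (s : ℂ) ^ n * ρ s = 0) :
    ρ =ᵐ[volume.restrict (Set.Icc 0 1)] 0 := by
  have hloc : LocallyIntegrable ((Set.Icc (0 : ℝ) 1).indicator ρ) volume :=
    (hρ.integrable_indicator measurableSet_Icc).locallyIntegrable
  have hz := ae_eq_zero_of_integral_contDiff_smul_eq_zero hloc fun g hg _ => by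
    have e : ∀ s, g s • (Set.Icc (0 : ℝ) 1).indicator ρ s =
        (Set.Icc (0 : ℝ) 1).indicator (fun s => (g s : ℂ) * ρ s) s := fun s => by
      by_cases hs : s ∈ Set.Icc (0 : ℝ) 1 <;> simp [hs]
    simp only [e]
    rw [integral_indicator measurableSet_Icc]
    set J := ∫ s in Set.Icc (0 : ℝ) 1, ‖ρ s‖
    have hJ : 0 ≤ J := integral_nonneg fun s => norm_nonneg _
    have hgi : IntegrableOn (fun s : ℝ => (g s : ℂ) * ρ s) (Set.Icc 0 1) :=
      hρ.continuousOn_mul (Complex.continuous_ofReal.comp hg.continuous).continuousOn isCompact_Icc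
    rw [← norm_le_zero_iff]
    refine le_of_forall_pos_le_add fun ε hε => ?_
    obtain ⟨P, hP⟩ := exists_polynomial_near_of_continuousOn 0 1 g hg.continuous.continuousOn
      (ε / (J + 1)) (by positivity)
    have hPi : IntegrableOn (fun s : ℝ => ((P.eval s : ℝ) : ℂ) * ρ s) (Set.Icc 0 1) :=
      hρ.continuousOn_mul (Complex.continuous_ofReal.comp P.continuous).continuousOn isCompact_Icc
    have h1 : ∫ s in Set.Icc (0 : ℝ) 1, (g s : ℂ) * ρ s =
        ∫ s in Set.Icc (0 : ℝ) 1, ((g s : ℂ) * ρ s - ((P.eval s : ℝ) : ℂ) * ρ s) := by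
      rw [integral_sub hgi hPi, integral_polynomial_mul_eq_zero hρ h, sub_zero]
    have h2 : ‖∫ s in Set.Icc (0 : ℝ) 1, (g s : ℂ) * ρ s‖ ≤ ε / (J + 1) * J := by
      rw [h1, ← integral_const_mul]
      refine norm_integral_le_of_norm_le (hρ.norm.const_mul _) ?_
      filter_upwards [ae_restrict_mem measurableSet_Icc] with s hs
      rw [← sub_mul, norm_mul, ← Complex.ofReal_sub, Complex.norm_real, Real.norm_eq_abs, abs_sub_comm]
      exact mul_le_mul_of_nonneg_right (hP s hs).le (norm_nonneg _)
    have h3 : ε / (J + 1) * J ≤ ε := by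
      rw [div_mul_eq_mul_div, div_le_iff₀ (by positivity)]
      nlinarith
    linarith
  filter_upwards [ae_restrict_of_ae hz, ae_restrict_mem measurableSet_Icc] with s h1 hs
  simpa [hs] using h1

theorem ae_eq_of_moments_eq {ρ₁ ρ₂ : ℝ → ℂ} (h₁ : IntegrableOn ρ₁ (Set.Icc 0 1))
    (h₂ : IntegrableOn ρ₂ (Set.Icc 0 1))
    (h : ∀ n : ℕ, ∫ s in Set.Icc (0 : ℝ) 1, (s : ℂ) ^ n * ρ₁ s =
      ∫ s in Set.Icc (0 : ℝ) 1, (s : ℂ) ^ n * ρ₂ s) :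
    ρ₁ =ᵐ[volume.restrict (Set.Icc 0 1)] ρ₂ := by
  have hz := ae_eq_zero_of_moments_eq_zero (h₁.sub h₂) fun n => by
    have e : ∀ s : ℝ, (s : ℂ) ^ n * (ρ₁ - ρ₂) s = (s : ℂ) ^ n * ρ₁ s - (s : ℂ) ^ n * ρ₂ s :=
      fun s => by simp [mul_sub]
    simp only [e]
    rw [integral_sub (h₁.continuousOn_mul (by fun_prop) isCompact_Icc)
      (h₂.continuousOn_mul (by fun_prop) isCompact_Icc), h n, sub_self]
  filter_upwards [hz] with s hs
  simpa [sub_eq_zero] using hs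

end Moments

/-! ### Coefficients and convergence of the hypergeometric series. -/

section PowerSeries

theorem coeff_eq_of_tsum_eventually_eq {u v : ℕ → ℂ} {r : ℝ} (hr : 0 < r)
    (hu : Summable fun n => ‖u n‖ * r ^ n) (hv : Summable fun n => ‖v n‖ * r ^ n)
    (h : ∀ z : ℂ, ‖z‖ < r → ∑' n, u n * z ^ n = ∑' n, v n * z ^ n) : u = v := by
  have key : ∀ w : ℕ → ℂ, (Summable fun n => ‖w n‖ * r ^ n) →
      HasFPowerSeriesAt (fun z => ∑' n, w n * z ^ n)
        (FormalMultilinearSeries.ofScalars ℂ w) 0 := fun w hw => by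
    have h1 : (r.toNNReal : ENNReal) ≤ (FormalMultilinearSeries.ofScalars ℂ w).radius := by
      refine FormalMultilinearSeries.le_radius_of_summable _ ?_
      simpa [FormalMultilinearSeries.ofScalars_norm, hr.le] using hw
    have h2 : 0 < (FormalMultilinearSeries.ofScalars ℂ w).radius :=
      lt_of_lt_of_le (by simpa using hr) h1
    have h3 := ((FormalMultilinearSeries.ofScalars ℂ w).hasFPowerSeriesOnBall h2).hasFPowerSeriesAt
    have e : (FormalMultilinearSeries.ofScalars ℂ w).sum = fun z => ∑' n, w n * z ^ n := by
      funext z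
      simp [FormalMultilinearSeries.sum, mul_comm]
    rwa [e] at h3
  have heq : (fun z : ℂ => ∑' n, u n * z ^ n) =ᶠ[𝓝 0] fun z => ∑' n, v n * z ^ n := by
    filter_upwards [Metric.ball_mem_nhds (0 : ℂ) hr] with z hz
    exact h z (by simpa using hz)
  exact FormalMultilinearSeries.ofScalars_series_injective ℂ ℂ
    ((key u hu).eq_formalMultilinearSeries ((key v hv).congr heq.symm))

theorem natCast_add_div_tendsto_one (x y : ℂ) :
    Tendsto (fun n : ℕ => (x + n) / (y + n)) atTop (𝓝 1) := by
  have key : ∀ x : ℂ, Tendsto (fun n : ℕ => x * (n : ℂ)⁻¹ + 1) atTop (𝓝 1) := fun x => by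
    simpa using (((tendsto_inv₀_cobounded (α := ℂ)).comp
      tendsto_natCast_atTop_cobounded).const_mul x).add_const 1
  have h := (key x).div (key y) one_ne_zero
  rw [div_one] at h
  refine h.congr' ?_
  filter_upwards [eventually_gt_atTop 0] with n hn
  have hn' : (n : ℂ) ≠ 0 := by exact_mod_cast hn.ne'
  simp only [Pi.div_apply]
  rw [← mul_div_mul_right (x * (n : ℂ)⁻¹ + 1) _ hn']
  field_simp

theorem risingFactorial_succ (x : ℂ) (n : ℕ) :
    risingFactorial x (n + 1) = risingFactorial x n * (x + n) := Finset.prod_range_succ _ _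

/-- The quotient `(a_1)_n ⋯ (a_q)_n / ((b_1)_n ⋯ (b_q)_n)`. -/
noncomputable def hypMoment {q : ℕ} (a b : Fin q → ℂ) (n : ℕ) : ℂ :=
  (∏ i, risingFactorial (a i) n) / ∏ i, risingFactorial (b i) n

theorem hypMoment_succ {q : ℕ} (a b : Fin q → ℂ) (n : ℕ) :
    hypMoment a b (n + 1) = hypMoment a b n * ∏ i, ((a i + n) / (b i + n)) := by
  simp only [hypMoment, risingFactorial_succ, Finset.prod_mul_distrib, Finset.prod_div_distrib]
  rw [mul_div_mul_comm]

theorem hypSeries_eq {q : ℕ} (σ : ℂ) (a b : Fin q → ℂ) (z : ℂ) :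
    hypSeries σ a b z =
      ∑' n : ℕ, risingFactorial σ n / (n.factorial : ℂ) * hypMoment a b n * z ^ n := by
  refine tsum_congr fun n => ?_
  rw [hypMoment, div_mul_div_comm]
  ring

theorem summable_hyp_coeff {q : ℕ} (σ : ℂ) (a b : Fin q → ℂ) {r : ℝ} (hr : 0 < r) (hr1 : r < 1) :
    Summable fun n : ℕ =>
      ‖risingFactorial σ n / (n.factorial : ℂ) * hypMoment a b n‖ * r ^ n := by
  have h1 : Tendsto (fun n : ℕ => ‖(σ + n) / (1 + n) * ∏ i, ((a i + n) / (b i + n))‖ * r) atTop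
      (𝓝 r) := by
    have h2 : Tendsto (fun n : ℕ => ∏ i, ((a i + n) / (b i + n))) atTop (𝓝 1) := by
      simpa using tendsto_finsetProd Finset.univ
        fun i _ => natCast_add_div_tendsto_one (a i) (b i)
    simpa using ((natCast_add_div_tendsto_one σ 1).mul h2).norm.mul_const r
  -- The ratio of consecutive terms tends to `r`; any number strictly between `r` and `1` would do.
  refine summable_of_ratio_norm_eventually_le (r := (1 + r) / 2) (by linarith) ?_
  filter_upwards [h1.eventually_le_const (show r < (1 + r) / 2 by linarith)] with n hn
  have e : risingFactorial σ (n + 1) / ((n + 1).factorial : ℂ) * hypMoment a b (n + 1) =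
      (risingFactorial σ n / (n.factorial : ℂ) * hypMoment a b n) *
        ((σ + n) / (1 + n) * ∏ i, ((a i + n) / (b i + n))) := by
    rw [hypMoment_succ, risingFactorial_succ, Nat.factorial_succ]
    push_cast
    rw [add_comm (n : ℂ) 1, mul_comm (1 + (n : ℂ)), mul_div_mul_comm]
    ring
  have hnn : ∀ m : ℕ, 0 ≤ ‖risingFactorial σ m / (m.factorial : ℂ) * hypMoment a b m‖ * r ^ m :=
    fun m => by positivity
  rw [Real.norm_of_nonneg (hnn (n + 1)), Real.norm_of_nonneg (hnn n), e,
    norm_mul (risingFactorial σ n / (n.factorial : ℂ) * hypMoment a b n), pow_succ]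
  calc _ = (‖(σ + n) / (1 + n) * ∏ i, ((a i + n) / (b i + n))‖ * r) *
        (‖risingFactorial σ n / (n.factorial : ℂ) * hypMoment a b n‖ * r ^ n) := by ring
    _ ≤ _ := mul_le_mul_of_nonneg_right hn (by positivity)

/-- Translates the binomial series for `1 / (1 - x) ^ σ` into rising factorials. -/
theorem ring_choose_eq_risingFactorial_div (σ : ℂ) (n : ℕ) :
    Ring.choose (σ + n - 1) n = risingFactorial σ n / (n.factorial : ℂ) := by
  have h := Ring.factorial_nsmul_multichoose_eq_ascPochhammer σ n
  have h1 : ∀ n : ℕ, (ascPochhammer ℂ n).eval σ = risingFactorial σ n := fun n => by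
    induction n with
    | zero => simp [risingFactorial]
    | succ n ih => rw [ascPochhammer_succ_eval, ih, risingFactorial_succ]
  rw [Polynomial.ascPochhammer_smeval_cast, Polynomial.ascPochhammer_smeval_eq_eval, h1,
    nsmul_eq_mul, Ring.multichoose_eq] at h
  rw [eq_div_iff (by exact_mod_cast n.factorial_ne_zero), mul_comm]
  exact h

end PowerSeries

/-! ### Equivalence of the representation with the moment identities. -/

section Representation

open Complex

/-- The generalized Stieltjes transform `∫₀¹ ρ(s) (1 - s z) ^ (-σ) ds`. -/
noncomputable def stieltjesTransform (σ : ℂ) (ρ : ℝ → ℂ) (z : ℂ) : ℂ :=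
  ∫ s in Set.Icc (0 : ℝ) 1, ρ s / (1 - (s : ℂ) * z) ^ σ

variable {ρ : ℝ → ℂ}

theorem summable_risingFactorial_mul_pow (σ : ℂ) {r : ℝ} (hr : 0 < r) (hr1 : r < 1) :
    Summable fun n : ℕ => ‖risingFactorial σ n / (n.factorial : ℂ)‖ * r ^ n := by
  simpa [hypMoment] using summable_hyp_coeff (q := 0) σ ![] ![] hr hr1

theorem hasSum_one_div_one_sub_cpow (σ : ℂ) {x : ℂ} (hx : ‖x‖ < 1) :
    HasSum (fun n : ℕ => risingFactorial σ n / (n.factorial : ℂ) * x ^ n) (1 / (1 - x) ^ σ) := by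
  have h := (one_div_one_sub_cpow_hasFPowerSeriesOnBall_zero σ).hasSum (y := x) (by
    rw [← ENNReal.ofReal_one, Metric.eball_ofReal]; simpa using hx)
  simpa [ring_choose_eq_risingFactorial_div, mul_comm] using h

theorem hasSum_stieltjesTransform (σ : ℂ) (hρ : IntegrableOn ρ (Set.Icc 0 1)) {z : ℂ}
    (hz : ‖z‖ < 1) :
    HasSum (fun n : ℕ => risingFactorial σ n / (n.factorial : ℂ) *
      (∫ s in Set.Icc (0 : ℝ) 1, (s : ℂ) ^ n * ρ s) * z ^ n) (stieltjesTransform σ ρ z) := by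
  obtain ⟨r, hzr, hr1⟩ := exists_between hz
  have hr : 0 < r := (norm_nonneg z).trans_lt hzr
  set c : ℕ → ℂ := fun n => risingFactorial σ n / (n.factorial : ℂ)
  have hsum : Summable fun n => ‖c n‖ * r ^ n := summable_risingFactorial_mul_pow σ hr hr1
  have h := hasSum_integral_of_dominated_convergence (μ := volume.restrict (Set.Icc (0 : ℝ) 1))
    (F := fun (n : ℕ) (s : ℝ) => c n * ((s : ℂ) ^ n * ρ s) * z ^ n)
    (f := fun s : ℝ => ρ s / (1 - (s : ℂ) * z) ^ σ)
    (fun n s => ‖c n‖ * r ^ n * ‖ρ s‖) (fun n => ?_) (fun n => ?_) ?_ ?_ ?_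
  · simp only [integral_mul_const, integral_const_mul] at h
    exact h
  · exact ((hρ.continuousOn_mul (g := fun s : ℝ => (s : ℂ) ^ n) (by fun_prop)
      isCompact_Icc).aestronglyMeasurable.const_mul _).mul_const _
  · filter_upwards [ae_restrict_mem measurableSet_Icc] with s hs
    rw [norm_mul, norm_mul, norm_mul, norm_pow, norm_pow, norm_real, Real.norm_of_nonneg hs.1]
    have h1 : s ^ n ≤ 1 := pow_le_one₀ hs.1 hs.2
    have h2 : ‖z‖ ^ n ≤ r ^ n := pow_le_pow_left₀ (norm_nonneg _) hzr.le n
    calc _ = ‖c n‖ * ‖z‖ ^ n * (s ^ n * ‖ρ s‖) := by ring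
      _ ≤ ‖c n‖ * r ^ n * (1 * ‖ρ s‖) := by
        have := hs.1
        gcongr
      _ = _ := by ring
  · exact Eventually.of_forall fun s => hsum.mul_right _
  · simp only [tsum_mul_right]
    exact hρ.norm.const_mul _
  · filter_upwards [ae_restrict_mem measurableSet_Icc] with s hs
    have hx : ‖(s : ℂ) * z‖ < 1 := by
      rw [norm_mul, norm_real, Real.norm_of_nonneg hs.1]
      exact (mul_le_of_le_one_left (norm_nonneg _) hs.2).trans_lt hz
    have := (hasSum_one_div_one_sub_cpow σ hx).mul_right (ρ s)
    rw [one_div_mul_eq_div] at this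
    refine this.congr_fun fun n => ?_
    simp only [c, mul_pow]; ring

theorem isOpen_cutPlane : IsOpen cutPlane :=
  isOpen_slitPlane.preimage (by fun_prop : Continuous fun z : ℂ => 1 - z)

theorem one_sub_mul_mem_slitPlane {z : ℂ} (hz : z ∈ cutPlane) {s : ℝ} (hs : s ∈ Set.Icc (0 : ℝ) 1) :
    1 - (s : ℂ) * z ∈ slitPlane := by
  have h := StarConvex.add_smul_mem (x := (1 : ℂ)) (y := -z) starConvex_one_slitPlane
    (by rw [← sub_eq_add_neg]; exact hz) hs.1 hs.2
  rw [real_smul] at h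
  convert h using 1; ring

theorem mem_cutPlane_of_norm_lt_one {z : ℂ} (hz : ‖z‖ < 1) : z ∈ cutPlane := by
  have := mem_slitPlane_of_norm_lt_one (z := -z) (by simpa using hz)
  rwa [← sub_eq_add_neg] at this

theorem isPreconnected_cutPlane : IsPreconnected cutPlane := by
  have h : StarConvex ℝ (0 : ℂ) cutPlane := by
    rw [starConvex_zero_iff]
    intro z hz s h0 h1
    rw [real_smul]
    exact one_sub_mul_mem_slitPlane hz ⟨h0, h1⟩
  exact (h.isPathConnected (mem_cutPlane_of_norm_lt_one (by simp))).isConnected.isPreconnected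

/-- Differentiation under the integral sign. For `z` in a closed ball inside the cut plane and `s ∈
[0, 1]`, `1 - s z` stays in the slit plane, so the derivative of the kernel is bounded by
compactness. -/
theorem differentiableOn_stieltjesTransform (σ : ℂ) (hρ : IntegrableOn ρ (Set.Icc 0 1)) :
    DifferentiableOn ℂ (stieltjesTransform σ ρ) cutPlane := by
  intro z₀ hz₀
  obtain ⟨η, hη, hball⟩ := Metric.nhds_basis_closedBall.mem_iff.1
    (isOpen_cutPlane.mem_nhds hz₀)
  set B := Metric.closedBall z₀ η
  have hslit : ∀ z ∈ B, ∀ s ∈ Set.Icc (0 : ℝ) 1, 1 - (s : ℂ) * z ∈ slitPlane := fun z hz s hs =>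
    one_sub_mul_mem_slitPlane (hball hz) hs
  have hcont : ∀ w : ℂ, ContinuousOn (fun x : ℂ × ℝ => (1 - (x.2 : ℂ) * x.1) ^ w)
      (B ×ˢ Set.Icc (0 : ℝ) 1) := fun w =>
    ContinuousOn.cpow (by fun_prop) continuousOn_const fun x hx => hslit x.1 hx.1 x.2 hx.2
  have hcont' : ∀ w : ℂ, ∀ z ∈ B, ContinuousOn (fun s : ℝ => (1 - (s : ℂ) * z) ^ w)
      (Set.Icc (0 : ℝ) 1) := fun w z hz =>
    ContinuousOn.cpow (by fun_prop) continuousOn_const fun s hs => hslit z hz s hs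
  have hG : ContinuousOn (fun x : ℂ × ℝ => σ * x.2 * (1 - (x.2 : ℂ) * x.1) ^ (-σ - 1))
      (B ×ˢ Set.Icc (0 : ℝ) 1) := ContinuousOn.mul (by fun_prop) (hcont _)
  obtain ⟨M, hM⟩ := ((isCompact_closedBall z₀ η).prod isCompact_Icc).exists_bound_of_continuousOn hG
  have hz₀B : z₀ ∈ B := Metric.mem_closedBall_self hη.le
  have e : stieltjesTransform σ ρ = fun z =>
      ∫ s in Set.Icc (0 : ℝ) 1, (1 - (s : ℂ) * z) ^ (-σ) * ρ s := by
    funext z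
    simp only [stieltjesTransform, cpow_neg, div_eq_mul_inv, mul_comm]
  rw [e]
  have hmeas : ∀ z ∈ B, ∀ w : ℂ, IntegrableOn (fun s : ℝ => (1 - (s : ℂ) * z) ^ w * ρ s)
      (Set.Icc (0 : ℝ) 1) := fun z hz w => hρ.continuousOn_mul (hcont' w z hz) isCompact_Icc
  have h := hasDerivAt_integral_of_dominated_loc_of_deriv_le
    (μ := volume.restrict (Set.Icc (0 : ℝ) 1)) (𝕜 := ℂ)
    (F := fun z (s : ℝ) => (1 - (s : ℂ) * z) ^ (-σ) * ρ s)
    (F' := fun z (s : ℝ) => (σ * s * (1 - (s : ℂ) * z) ^ (-σ - 1)) * ρ s)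
    (x₀ := z₀) (s := B) (bound := fun s => M * ‖ρ s‖)
    (Metric.closedBall_mem_nhds z₀ hη) ?_ (hmeas z₀ hz₀B _) ?_ ?_ (hρ.norm.const_mul M) ?_
  · exact h.2.differentiableAt.differentiableWithinAt
  · filter_upwards [Metric.closedBall_mem_nhds z₀ hη] with z hz
    exact (hmeas z hz _).aestronglyMeasurable
  · exact (hρ.continuousOn_mul (ContinuousOn.mul (by fun_prop) (hcont' _ z₀ hz₀B))
      isCompact_Icc).aestronglyMeasurable
  · filter_upwards [ae_restrict_mem measurableSet_Icc] with s hs z hz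
    rw [norm_mul]
    exact mul_le_mul_of_nonneg_right (hM (z, s) ⟨hz, hs⟩) (norm_nonneg _)
  · filter_upwards [ae_restrict_mem measurableSet_Icc] with s hs z hz
    have h1 : HasDerivAt (fun z : ℂ => 1 - (s : ℂ) * z) (-(s : ℂ)) z := by
      simpa using ((hasDerivAt_id z).const_mul (s : ℂ)).const_sub 1
    have h2 := (h1.cpow_const (c := -σ) (hslit z hz s hs)).mul_const (ρ s)
    refine h2.congr_deriv ?_
    ring

variable {q : ℕ} {a b : Fin q → ℂ}

theorem hypF_eq_hypSeries (σ : ℂ) (a b : Fin q → ℂ) {z : ℂ} (hz : ‖z‖ < 1) :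
    hypF σ a b z = hypSeries σ a b z := by
  unfold hypF
  split_ifs with h
  · exact h.choose_spec.2 z hz
  · rfl

/-- `hypF` is an arbitrarily chosen continuation; the identity theorem on the connected cut plane
makes the choice immaterial. -/
theorem hypF_eq_of_isHypContinuation {σ : ℂ} {f : ℂ → ℂ} (hf : IsHypContinuation σ a b f) {z : ℂ}
    (hz : z ∈ cutPlane) : hypF σ a b z = f z := by
  have h : ∃ f : ℂ → ℂ, IsHypContinuation σ a b f := ⟨f, hf⟩
  rw [hypF, dif_pos h]
  have hev : h.choose =ᶠ[𝓝 0] f := by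
    filter_upwards [Metric.ball_mem_nhds (0 : ℂ) one_pos] with w hw
    have hw' : ‖w‖ < 1 := by simpa using hw
    rw [h.choose_spec.2 w hw', hf.2 w hw']
  exact (h.choose_spec.1.analyticOnNhd isOpen_cutPlane).eqOn_of_preconnected_of_eventuallyEq
    (hf.1.analyticOnNhd isOpen_cutPlane) isPreconnected_cutPlane
    (mem_cutPlane_of_norm_lt_one (by simp)) hev hz

theorem intervalIntegral_eq_stieltjesTransform (σ : ℂ) (ρ : ℝ → ℂ) (z : ℂ) :
    ∫ s in (0 : ℝ)..1, ρ s / (1 + (s : ℂ) * z) ^ σ = stieltjesTransform σ ρ (-z) := by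
  rw [intervalIntegral.integral_of_le zero_le_one, ← integral_Icc_eq_integral_Ioc,
    stieltjesTransform]
  simp

theorem isRepresentedBy_of_moments (σ : ℂ) (hρ : IntegrableOn ρ (Set.Icc 0 1))
    (h : ∀ n : ℕ, ∫ s in Set.Icc (0 : ℝ) 1, (s : ℂ) ^ n * ρ s = hypMoment a b n) :
    IsRepresentedBy σ a b ρ := by
  refine ⟨hρ, fun z hz => ?_⟩
  have hf : IsHypContinuation σ a b (stieltjesTransform σ ρ) := by
    refine ⟨differentiableOn_stieltjesTransform σ hρ, fun z hz => ?_⟩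
    rw [hypSeries_eq, ← (hasSum_stieltjesTransform σ hρ hz).tsum_eq]
    simp only [h]
  rw [intervalIntegral_eq_stieltjesTransform]
  exact hypF_eq_of_isHypContinuation hf (by simpa [cutPlane] using hz)

theorem risingFactorial_ne_zero {x : ℂ} (hx : ∀ n : ℕ, x ≠ -(n : ℂ)) (n : ℕ) :
    risingFactorial x n ≠ 0 :=
  Finset.prod_ne_zero_iff.2 fun k _ h => hx k (eq_neg_of_add_eq_zero_left h)

/-- Comparing Taylor coefficients at `0` yields the moments only after division by `(σ)_n`, hence
the condition on `σ`. -/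
theorem IsRepresentedBy.moments {σ : ℂ} (hσ : ∀ n : ℕ, σ ≠ -(n : ℂ))
    (h : IsRepresentedBy σ a b ρ) (n : ℕ) :
    ∫ s in Set.Icc (0 : ℝ) 1, (s : ℂ) ^ n * ρ s = hypMoment a b n := by
  have hhalf : (0 : ℝ) < 1 / 2 := by norm_num
  have hv := (hasSum_stieltjesTransform σ h.1 (z := (1 / 2 : ℂ)) (by norm_num)).summable.norm
  have key := coeff_eq_of_tsum_eventually_eq hhalf
    (u := fun n => risingFactorial σ n / (n.factorial : ℂ) *
      ∫ s in Set.Icc (0 : ℝ) 1, (s : ℂ) ^ n * ρ s)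
    (v := fun n => risingFactorial σ n / (n.factorial : ℂ) * hypMoment a b n)
    (hv.congr fun n => by rw [norm_mul, norm_pow]; norm_num)
    (summable_hyp_coeff σ a b hhalf (by norm_num)) fun z hz => by
      have hz1 : ‖z‖ < 1 := by linarith
      rw [← hypSeries_eq, (hasSum_stieltjesTransform σ h.1 hz1).tsum_eq,
        ← hypF_eq_hypSeries σ a b hz1, ← neg_neg z, h.2 (-z) (by
          rw [← sub_eq_add_neg]; exact mem_cutPlane_of_norm_lt_one hz1),
        intervalIntegral_eq_stieltjesTransform]
  have hc : risingFactorial σ n / (n.factorial : ℂ) ≠ 0 :=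
    div_ne_zero (risingFactorial_ne_zero hσ n) (by exact_mod_cast n.factorial_ne_zero)
  exact mul_left_cancel₀ hc (congrFun key n)

end Representation

/-! ### Necessity of the conditions on `ψ` and on the upper parameters. -/

section Necessity

open Complex

variable {q : ℕ} {a b : Fin q → ℂ} {ρ : ℝ → ℂ}

theorem hypMoment_zero (a b : Fin q → ℂ) : hypMoment a b 0 = 1 := by
  simp [hypMoment, risingFactorial]

theorem prod_Gamma_div_mul_gammaProd (ha : ∀ i, ∀ n : ℕ, a i ≠ -n) (hb : ∀ i, ∀ n : ℕ, b i ≠ -n)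
    (n : ℕ) : (∏ i, Gamma (b i) / Gamma (a i)) * gammaProd a b n = hypMoment a b n := by
  simp only [gammaProd, hypMoment, ← Finset.prod_div_distrib, ← Finset.prod_mul_distrib]
  refine Finset.prod_congr rfl fun i _ => ?_
  rw [Gamma_add_nat_eq_prod (ha i), Gamma_add_nat_eq_prod (hb i)]
  have h1 := Gamma_ne_zero (ha i)
  have h2 := Gamma_ne_zero (hb i)
  rw [risingFactorial, risingFactorial, mul_comm _ (Gamma (a i)), mul_comm _ (Gamma (b i)),
    mul_div_mul_comm]
  field_simp

theorem integrableOn_pow_mul (hρ : IntegrableOn ρ (Set.Icc 0 1)) (n : ℕ) :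
    IntegrableOn (fun s : ℝ => (s : ℂ) ^ n * ρ s) (Set.Icc 0 1) :=
  hρ.continuousOn_mul (by fun_prop) isCompact_Icc

/-- If `a_i = -m`, all moments of `s ^ (m + 1) ρ` vanish, so `ρ = 0` almost everywhere, although its
zeroth moment is `1`. -/
theorem ne_neg_nat_of_moments (hρ : IntegrableOn ρ (Set.Icc 0 1))
    (h : ∀ n : ℕ, ∫ s in Set.Icc (0 : ℝ) 1, (s : ℂ) ^ n * ρ s = hypMoment a b n) (i : Fin q)
    (m : ℕ) : a i ≠ -m := fun hi => by
  have hz : ∀ n : ℕ, hypMoment a b (n + (m + 1)) = 0 := fun n => by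
    rw [hypMoment, div_eq_zero_iff]
    refine Or.inl (Finset.prod_eq_zero (Finset.mem_univ i) ?_)
    exact Finset.prod_eq_zero (Finset.mem_range.2 (show m < n + (m + 1) by omega)) (by simp [hi])
  have h1 := ae_eq_zero_of_moments_eq_zero (integrableOn_pow_mul hρ (m + 1)) fun n => by
    simp only [← mul_assoc, ← pow_add]
    rw [h, hz]
  have h2 : ∫ s in Set.Icc (0 : ℝ) 1, (s : ℂ) ^ 0 * ρ s = 0 := by
    rw [integral_Icc_eq_integral_Ioc]
    refine integral_eq_zero_of_ae ?_
    filter_upwards [ae_restrict_of_ae_restrict_of_subset Set.Ioc_subset_Icc_self h1,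
      ae_restrict_mem measurableSet_Ioc] with s hs hs'
    have : (s : ℂ) ≠ 0 := by exact_mod_cast hs'.1.ne'
    simpa [this] using hs
  rw [h, hypMoment_zero] at h2
  exact one_ne_zero h2

theorem moments_tendsto_zero (hρ : IntegrableOn ρ (Set.Icc 0 1)) :
    Tendsto (fun n : ℕ => ∫ s in Set.Icc (0 : ℝ) 1, (s : ℂ) ^ n * ρ s) atTop (𝓝 0) := by
  simp only [integral_Icc_eq_integral_Ioo]
  have hz : (0 : ℂ) = ∫ s in Set.Ioo (0 : ℝ) 1, (0 : ℂ) := by simp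
  rw [hz]
  refine tendsto_integral_of_dominated_convergence (fun s => ‖ρ s‖)
    (fun n => ((integrableOn_pow_mul hρ n).mono_set Set.Ioo_subset_Icc_self).aestronglyMeasurable)
    (hρ.mono_set Set.Ioo_subset_Icc_self).norm (fun n => ?_) ?_
  · filter_upwards [ae_restrict_mem measurableSet_Ioo] with s hs
    rw [norm_mul, norm_pow, norm_real, Real.norm_of_nonneg hs.1.le]
    exact mul_le_of_le_one_left (norm_nonneg _) (pow_le_one₀ hs.1.le hs.2.le)
  · filter_upwards [ae_restrict_mem measurableSet_Ioo] with s hs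
    have := (tendsto_pow_atTop_nhds_zero_of_norm_lt_one (x := (s : ℂ)) (by
      rw [norm_real, Real.norm_of_nonneg hs.1.le]; exact hs.2)).mul_const (ρ s)
    rwa [zero_mul] at this

/-- The index `n + 1` appears because Euler's product has `n + 1` factors. -/
theorem hypMoment_mul_cpow_tendsto (ha : ∀ i, ∀ n : ℕ, a i ≠ -n) (b : Fin q → ℂ) :
    Tendsto (fun n : ℕ => hypMoment a b (n + 1) * (n : ℂ) ^ hypPsi a b) atTop
      (𝓝 (∏ i, Gamma (b i) / Gamma (a i))) := by
  refine (tendsto_finsetProd Finset.univ fun i _ =>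
    prod_gammaSeq_denominators_tendsto (s := a i) (t := b i) (ha i)).congr' ?_
  filter_upwards [eventually_gt_atTop 0] with n hn
  have hn' : (n : ℂ) ≠ 0 := by exact_mod_cast hn.ne'
  rw [Finset.prod_mul_distrib, Finset.prod_div_distrib, hypMoment, hypPsi]
  simp only [cpow_def_of_ne_zero hn', Finset.mul_sum, exp_sum]
  rfl

/-- If `Re ψ ≤ 0`, then `|n ^ ψ| ≤ 1`, and the decay of the moments would force the nonzero limit in
`hypMoment_mul_cpow_tendsto` to be zero. -/
theorem hypPsi_re_pos_of_moments (hb : ∀ i, ∀ n : ℕ, b i ≠ -n)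
    (hρ : IntegrableOn ρ (Set.Icc 0 1))
    (h : ∀ n : ℕ, ∫ s in Set.Icc (0 : ℝ) 1, (s : ℂ) ^ n * ρ s = hypMoment a b n) :
    0 < (hypPsi a b).re := by
  have ha := ne_neg_nat_of_moments hρ h
  by_contra! hψ
  have h1 := (moments_tendsto_zero hρ).comp (tendsto_add_atTop_nat 1)
  simp only [Function.comp_def, h] at h1
  have h2 : Tendsto (fun n : ℕ => hypMoment a b (n + 1) * (n : ℂ) ^ hypPsi a b) atTop (𝓝 0) := by
    refine squeeze_zero_norm' ?_ (tendsto_zero_iff_norm_tendsto_zero.1 h1)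
    filter_upwards [eventually_gt_atTop 0] with n hn
    rw [norm_mul, norm_natCast_cpow_of_pos hn]
    exact mul_le_of_le_one_right (norm_nonneg _)
      (Real.rpow_le_one_of_one_le_of_nonpos (by exact_mod_cast hn) hψ)
  have h3 := tendsto_nhds_unique (hypMoment_mul_cpow_tendsto ha b) h2
  exact Finset.prod_ne_zero_iff.2
    (fun i _ => div_ne_zero (Gamma_ne_zero (hb i)) (Gamma_ne_zero (ha i))) h3

/-- The Mellin transform `∫₀¹ s ^ w ρ(s) ds`. -/
noncomputable def unitMellin (ρ : ℝ → ℂ) (w : ℂ) : ℂ :=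
  ∫ s in Set.Ioo (0 : ℝ) 1, (s : ℂ) ^ w * ρ s

theorem aestronglyMeasurable_cpow_mul (hρ : IntegrableOn ρ (Set.Ioo 0 1)) (w : ℂ) :
    AEStronglyMeasurable (fun s : ℝ => (s : ℂ) ^ w * ρ s) (volume.restrict (Set.Ioo 0 1)) :=
  (measurable_ofReal_cpow w).aestronglyMeasurable.mul hρ.aestronglyMeasurable

theorem norm_cpow_mul_le {s : ℝ} (hs : s ∈ Set.Ioo (0 : ℝ) 1) {w : ℂ} (hw : 0 ≤ w.re) :
    ‖(s : ℂ) ^ w * ρ s‖ ≤ ‖ρ s‖ := by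
  rw [norm_mul, norm_ofReal_cpow hs.1]
  exact mul_le_of_le_one_left (norm_nonneg _) (Real.rpow_le_one hs.1.le hs.2.le hw)

theorem norm_unitMellin_le (hρ : IntegrableOn ρ (Set.Ioo 0 1)) {w : ℂ} (hw : 0 ≤ w.re) :
    ‖unitMellin ρ w‖ ≤ ∫ s in Set.Ioo (0 : ℝ) 1, ‖ρ s‖ := by
  refine norm_integral_le_of_norm_le hρ.norm ?_
  filter_upwards [ae_restrict_mem measurableSet_Ioo] with s hs
  exact norm_cpow_mul_le hs hw

theorem differentiableOn_unitMellin (hρ : IntegrableOn ρ (Set.Ioo 0 1)) :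
    DifferentiableOn ℂ (unitMellin ρ) {w | 0 < w.re} := by
  intro w₀ hw₀
  have hw₀ : 0 < w₀.re := hw₀
  set η := w₀.re / 2
  have hη : 0 < η := by positivity
  have hU : {w : ℂ | η < w.re} ∈ 𝓝 w₀ :=
    (isOpen_lt continuous_const continuous_re).mem_nhds (show η < w₀.re by simp only [η]; linarith)
  have h := hasDerivAt_integral_of_dominated_loc_of_deriv_le
    (μ := volume.restrict (Set.Ioo (0 : ℝ) 1)) (𝕜 := ℂ)
    (F := fun w (s : ℝ) => (s : ℂ) ^ w * ρ s)
    (F' := fun w (s : ℝ) => (s : ℂ) ^ w * log s * ρ s)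
    (x₀ := w₀) (bound := fun s => 1 / η * ‖ρ s‖) hU
    (Eventually.of_forall fun w => aestronglyMeasurable_cpow_mul hρ w) ?_ ?_ ?_
    (hρ.norm.const_mul _) ?_
  · exact h.2.differentiableAt.differentiableWithinAt
  · refine hρ.norm.mono' (aestronglyMeasurable_cpow_mul hρ w₀) ?_
    filter_upwards [ae_restrict_mem measurableSet_Ioo] with s hs
    exact norm_cpow_mul_le hs hw₀.le
  · exact ((measurable_ofReal_cpow w₀).mul (measurable_log.comp
      measurable_ofReal)).aestronglyMeasurable.mul hρ.aestronglyMeasurable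
  · filter_upwards [ae_restrict_mem measurableSet_Ioo] with s hs w hw
    have hw : η < w.re := hw
    rw [norm_mul, norm_mul, norm_ofReal_cpow hs.1, ← ofReal_log hs.1.le, norm_real,
      Real.norm_eq_abs]
    refine mul_le_mul_of_nonneg_right ?_ (norm_nonneg _)
    have h1 := Real.abs_log_mul_self_rpow_lt s η hs.1 hs.2.le hη
    rw [abs_mul, abs_of_pos (Real.rpow_pos_of_pos hs.1 η), mul_comm] at h1
    refine le_trans ?_ h1.le
    exact mul_le_mul_of_nonneg_right (Real.rpow_le_rpow_of_exponent_ge hs.1 hs.2.le hw.le)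
      (abs_nonneg _)
  · filter_upwards [ae_restrict_mem measurableSet_Ioo] with s hs w _
    have hs0 : (s : ℂ) ≠ 0 := by exact_mod_cast hs.1.ne'
    have h1 := ((hasDerivAt_id w).const_cpow (c := (s : ℂ)) (Or.inl hs0)).mul_const (ρ s)
    simpa using h1

/-- This passes from integer to real exponents. For large `N` the moments of `s ^ N ρ` are, up to a
constant, those of the explicit density with parameters raised by `N`, whose real parts are
positive. By uniqueness the two functions agree almost everywhere, and the Mellin transform of that
density is known for all real `t ≥ 0`. -/
theorem exists_unitMellin_eq (hb : ∀ i, ∀ n : ℕ, b i ≠ -n) (hρ : IntegrableOn ρ (Set.Icc 0 1))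
    (h : ∀ n : ℕ, ∫ s in Set.Icc (0 : ℝ) 1, (s : ℂ) ^ n * ρ s = hypMoment a b n) :
    ∃ N : ℕ, (∀ i, 0 < (a i).re + N) ∧ ∀ t : ℝ, 0 ≤ t → unitMellin ρ (N + t) =
      (∏ i, Gamma (b i) / Gamma (a i)) * gammaProd a b (N + t) := by
  have ha := ne_neg_nat_of_moments hρ h
  have hψ := hypPsi_re_pos_of_moments hb hρ h
  obtain ⟨N, hN⟩ : ∃ N : ℕ, ∀ i, 0 < (a i).re + N := by
    have : ∀ᶠ N : ℕ in atTop, ∀ i, 0 < (a i).re + N := eventually_all.2 fun i => by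
      filter_upwards [tendsto_natCast_atTop_atTop.eventually_gt_atTop (-(a i).re)] with N hN
      linarith
    exact this.exists
  refine ⟨N, hN, fun t ht => ?_⟩
  set a' : Fin q → ℂ := fun i => a i + N
  set b' : Fin q → ℂ := fun i => b i + N
  have ha' : ∀ i, 0 < (a' i).re := fun i => by simpa [a'] using hN i
  have hb' : ∀ i, ∀ n : ℕ, b' i ≠ -n := fun i n hi => hb i (N + n) (by
    push_cast; linear_combination hi)
  have hψ' : 0 < (hypPsi a' b').re := by rwa [hypPsi_add]
  have hc' : ∀ i, -(a' i).re < 0 := fun i => by linarith [ha' i]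
  set C := ∏ i, Gamma (b i) / Gamma (a i)
  set C' := ∏ i, Gamma (b' i) / Gamma (a' i)
  have hC' : C' ≠ 0 := Finset.prod_ne_zero_iff.2 fun i _ =>
    div_ne_zero (Gamma_ne_zero (hb' i)) (Gamma_ne_zero_of_re_pos (ha' i))
  have hρ' : IntegrableOn (fun s => C / C' * hypDensity 0 a' b' s) (Set.Icc 0 1) :=
    (integrableOn_hypDensity ha' hψ' hc').const_mul _
  have hae := ae_eq_of_moments_eq (integrableOn_pow_mul hρ N) hρ' fun n => by
    simp only [← mul_assoc, ← pow_add]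
    rw [h, ← prod_Gamma_div_mul_gammaProd ha hb]
    have h1 := integral_cpow_mul_hypDensity (b := b') ha' hψ' hc' (t := n) n.cast_nonneg
    simp only [ofReal_natCast, cpow_natCast] at h1
    simp only [mul_comm _ (C / C'), mul_assoc]
    rw [integral_const_mul, h1, gammaProd_add]
    push_cast
    rw [add_comm (n : ℂ), ← mul_assoc (C / C'), div_mul_cancel₀ _ hC']
  have h2 := integral_cpow_mul_hypDensity (b := b') ha' hψ' hc' ht
  rw [gammaProd_add] at h2
  rw [unitMellin]
  calc _ = ∫ s in Set.Ioo (0 : ℝ) 1, C / C' * ((s : ℂ) ^ (t : ℂ) * hypDensity 0 a' b' s) := by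
        refine integral_congr_ae ?_
        filter_upwards [ae_restrict_of_ae_restrict_of_subset Set.Ioo_subset_Icc_self hae,
          ae_restrict_mem measurableSet_Ioo] with s hs hs'
        have hs0 : (s : ℂ) ≠ 0 := by exact_mod_cast hs'.1.ne'
        rw [mul_left_comm, ← hs, cpow_add _ _ hs0, cpow_natCast]; ring
    _ = _ := by
        rw [integral_const_mul, ← integral_Icc_eq_integral_Ioo, h2, ← mul_assoc,
          div_mul_cancel₀ _ hC']

/-- Multiplied by the reciprocals of `Γ(a_i + w)`, both sides are holomorphic for `Re w > 0`
whatever the poles of `gammaProd`. They agree at real `x > N`, hence everywhere by the identity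
theorem. -/
theorem unitMellin_mul_prod_eq (hb : ∀ i, ∀ n : ℕ, b i ≠ -n) (hρ : IntegrableOn ρ (Set.Icc 0 1))
    (h : ∀ n : ℕ, ∫ s in Set.Icc (0 : ℝ) 1, (s : ℂ) ^ n * ρ s = hypMoment a b n) {w : ℂ}
    (hw : 0 < w.re) :
    unitMellin ρ w * ∏ i, (Gamma (a i + w))⁻¹ =
      (∏ i, Gamma (b i) / Gamma (a i)) * ∏ i, (Gamma (b i + w))⁻¹ := by
  obtain ⟨N, hN, hNt⟩ := exists_unitMellin_eq hb hρ h
  have hopen : IsOpen {w : ℂ | 0 < w.re} := isOpen_lt continuous_const continuous_re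
  have hprod : ∀ x : Fin q → ℂ, Differentiable ℂ fun w => ∏ i, (Gamma (x i + w))⁻¹ := fun x =>
    Differentiable.fun_finsetProd fun i _ =>
      differentiable_one_div_Gamma.comp (differentiable_id.const_add (x i))
  have h1 : AnalyticOnNhd ℂ (fun w => unitMellin ρ w * ∏ i, (Gamma (a i + w))⁻¹)
      {w : ℂ | 0 < w.re} :=
    ((differentiableOn_unitMellin (hρ.mono_set Set.Ioo_subset_Icc_self)).mul
      (hprod a).differentiableOn).analyticOnNhd hopen
  have h2 : AnalyticOnNhd ℂ (fun w => (∏ i, Gamma (b i) / Gamma (a i)) *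
      ∏ i, (Gamma (b i + w))⁻¹) {w : ℂ | 0 < w.re} :=
    ((hprod b).const_mul _).differentiableOn.analyticOnNhd hopen
  have hmap : Tendsto (fun x : ℝ => (x : ℂ)) (𝓝[≠] ((N : ℝ) + 1)) (𝓝[≠] (((N : ℝ) + 1 : ℝ) : ℂ)) :=
    tendsto_nhdsWithin_of_tendsto_nhds_of_eventually_within _
      (continuous_ofReal.continuousAt.tendsto.mono_left nhdsWithin_le_nhds)
      (eventually_nhdsWithin_of_forall fun x hx => by
        simpa only [Set.mem_compl_iff, Set.mem_singleton_iff, ofReal_inj] using hx)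
  refine h1.eqOn_of_preconnected_of_frequently_eq h2 (convex_halfSpace_re_gt 0).isPreconnected
    (z₀ := (((N : ℝ) + 1 : ℝ) : ℂ)) ?_ (hmap.frequently (Eventually.frequently ?_)) hw
  · rw [Set.mem_ofPred_eq, ofReal_re]; positivity
  · filter_upwards [nhdsWithin_le_nhds (eventually_gt_nhds (show (N : ℝ) < N + 1 by linarith))]
      with x hx
    have e : (x : ℂ) = N + ((x - N : ℝ) : ℂ) := by push_cast; ring
    have h3 := hNt (x - N) (by linarith)
    rw [← e] at h3
    have h4 : ∏ i, Gamma (a i + x) ≠ 0 := Finset.prod_ne_zero_iff.2 fun i _ =>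
      Gamma_ne_zero_of_re_pos (by
        have := hN i
        simp only [add_re, ofReal_re]; linarith)
    simp only [h3, gammaProd, Finset.prod_inv_distrib]
    field_simp

/-- Let `w = -a_i + ε` with `ε → 0+`, approaching from the right because `-a_i` may lie on the
boundary `Re w = 0`. The left side of `unitMellin_mul_prod_eq` tends to zero, being a bounded
transform times `1 / Γ(ε)` and bounded factors. The right side tends to a nonzero multiple of `∏ 1 /
Γ(b_j - a_i)`, which vanishes only when some `a_i - b_j` is a nonnegative integer. -/
theorem re_pos_of_moments (hb : ∀ i, ∀ n : ℕ, b i ≠ -n) (hρ : IntegrableOn ρ (Set.Icc 0 1))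
    (h : ∀ n : ℕ, ∫ s in Set.Icc (0 : ℝ) 1, (s : ℂ) ^ n * ρ s = hypMoment a b n) {i : Fin q}
    (hi : ∀ (j : Fin q) (l : ℕ), a i ≠ b j + l) : 0 < (a i).re := by
  by_contra! hai
  have ha := ne_neg_nat_of_moments hρ h
  have hcont : ∀ x : Fin q → ℂ, Tendsto (fun ε : ℝ => ∏ j, (Gamma (x j + (-a i + ε)))⁻¹) (𝓝[>] 0)
      (𝓝 (∏ j, (Gamma (x j - a i))⁻¹)) := fun x => by
    have hc : Continuous fun ε : ℝ => ∏ j, (Gamma (x j + (-a i + ε)))⁻¹ :=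
      continuous_finsetProd _ fun j _ =>
        differentiable_one_div_Gamma.continuous.comp (by fun_prop)
    have := (hc.tendsto 0).mono_left (nhdsWithin_le_nhds (s := Set.Ioi (0 : ℝ)))
    simpa [sub_eq_add_neg] using this
  have hre : ∀ ε : ℝ, 0 < ε → 0 < (-a i + ε).re := fun ε hε => by simp; linarith
  have h1 : Tendsto (fun ε : ℝ => unitMellin ρ (-a i + ε) * ∏ j, (Gamma (a j + (-a i + ε)))⁻¹)
      (𝓝[>] 0) (𝓝 0) := by
    have h2 := (hcont a).norm.const_mul (∫ s in Set.Ioo (0 : ℝ) 1, ‖ρ s‖)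
    rw [Finset.prod_eq_zero (Finset.mem_univ i) (by simp), norm_zero, mul_zero] at h2
    refine squeeze_zero_norm' ?_ h2
    filter_upwards [self_mem_nhdsWithin] with ε hε
    rw [norm_mul]
    exact mul_le_mul_of_nonneg_right (norm_unitMellin_le
      (hρ.mono_set Set.Ioo_subset_Icc_self) (hre ε hε).le) (norm_nonneg _)
  have h3 := ((hcont b).const_mul (∏ i, Gamma (b i) / Gamma (a i))).congr' (by
    filter_upwards [self_mem_nhdsWithin] with ε hε
    exact (unitMellin_mul_prod_eq hb hρ h (hre ε hε)).symm)
  refine mul_ne_zero ?_ ?_ (tendsto_nhds_unique h3 h1)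
  · exact Finset.prod_ne_zero_iff.2 fun j _ =>
      div_ne_zero (Gamma_ne_zero (hb j)) (Gamma_ne_zero (ha j))
  · refine Finset.prod_ne_zero_iff.2 fun j _ => inv_ne_zero (Gamma_ne_zero fun l hl => hi j l ?_)
    linear_combination -hl

end Necessity

theorem mainTheorem1 {q : ℕ} (σ : ℂ) (a b : Fin q → ℂ)
    (hb : ∀ (j : Fin q) (n : ℕ), b j ≠ -(n : ℂ)) :
    -- the criterion
    ((∀ n : ℕ, σ ≠ -(n : ℂ)) →
      (∀ (i j : Fin q) (l : ℕ), a i = b j + (l : ℂ) → 0 < (a i).re) →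
      ((∃ ρ : ℝ → ℂ, IsRepresentedBy σ a b ρ) ↔
        (∀ i, 0 < (a i).re) ∧ 0 < (hypPsi a b).re)) ∧
    -- necessity, without excluding coincidences between upper and lower parameters
    ((∀ n : ℕ, σ ≠ -(n : ℂ)) → (∃ ρ : ℝ → ℂ, IsRepresentedBy σ a b ρ) →
      0 < (hypPsi a b).re ∧
        ∀ i, (∀ (j : Fin q) (l : ℕ), a i ≠ b j + (l : ℂ)) → 0 < (a i).re) ∧
    -- sufficiency for every `σ`, with the explicit density, which is the only one
    ((∀ i, 0 < (a i).re) → 0 < (hypPsi a b).re →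
      ∀ c : ℝ, (∀ i, -(a i).re < c) →
        (∀ s : ℝ, 0 < s → s < 1 →
          Tendsto (meijerGTrunc c b a (s : ℂ)) atTop (𝓝 (meijerG c b a (s : ℂ)))) ∧
        IsRepresentedBy σ a b (hypDensity c a b) ∧
        ((∀ n : ℕ, σ ≠ -(n : ℂ)) → ∀ ρ : ℝ → ℂ, IsRepresentedBy σ a b ρ →
          ρ =ᵐ[volume.restrict (Set.Icc 0 1)] hypDensity c a b)) := by
  have necessity : (∀ n : ℕ, σ ≠ -(n : ℂ)) → (∃ ρ : ℝ → ℂ, IsRepresentedBy σ a b ρ) →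
      0 < (hypPsi a b).re ∧
        ∀ i, (∀ (j : Fin q) (l : ℕ), a i ≠ b j + (l : ℂ)) → 0 < (a i).re := by
    rintro hσ ⟨ρ, hρ⟩
    exact ⟨hypPsi_re_pos_of_moments hb hρ.1 (hρ.moments hσ),
      fun i hi => re_pos_of_moments hb hρ.1 (hρ.moments hσ) hi⟩
  have moments : (∀ i, 0 < (a i).re) → 0 < (hypPsi a b).re → ∀ c : ℝ, (∀ i, -(a i).re < c) →
      ∀ n : ℕ, ∫ s in Set.Icc (0 : ℝ) 1, (s : ℂ) ^ n * hypDensity c a b s = hypMoment a b n := by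
    intro ha hψ c hc n
    have h := integral_cpow_mul_hypDensity (b := b) ha hψ hc (t := n) n.cast_nonneg
    simp only [Complex.ofReal_natCast, Complex.cpow_natCast] at h
    rw [h, prod_Gamma_div_mul_gammaProd (fun i => Complex.ne_neg_nat_of_re_pos (ha i)) hb]
  have represented : (∀ i, 0 < (a i).re) → 0 < (hypPsi a b).re → ∀ c : ℝ,
      (∀ i, -(a i).re < c) → IsRepresentedBy σ a b (hypDensity c a b) :=
    fun ha hψ c hc => isRepresentedBy_of_moments σ (integrableOn_hypDensity ha hψ hc)
      (moments ha hψ c hc)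
  refine ⟨fun hσ hab => ⟨fun hex => ?_, fun h => ?_⟩, necessity, fun ha hψ c hc => ?_⟩
  · obtain ⟨hψ, hre⟩ := necessity hσ hex
    refine ⟨fun i => ?_, hψ⟩
    by_cases hi : ∃ (j : Fin q) (l : ℕ), a i = b j + (l : ℂ)
    · obtain ⟨j, l, hjl⟩ := hi
      exact hab i j l hjl
    · push Not at hi
      exact hre i hi
  -- The abscissa `c = 0` is admissible because every `Re a_i` is positive.
  · exact ⟨_, represented h.1 h.2 0 fun i => by linarith [h.1 i]⟩
  · refine ⟨fun s hs hs1 => meijerGTrunc_tendsto_meijerG hψ hc hs hs1, represented ha hψ c hc,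
      fun hσ ρ hρ => ae_eq_of_moments_eq hρ.1 (integrableOn_hypDensity ha hψ hc) fun n => ?_⟩
    rw [hρ.moments hσ, moments ha hψ c hc]
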